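/- **Setting.** Let $U\subseteq\mathbb R^d$ be open with coordinates $x^i$, let the ground field be $\mathbb R$ or $\mathbb C$, and let $p_i$ be the fibre coordinates on $T^*U$; write $\partial_i=\partial/\partial x^i$, $\tilde\partial^i=\partial/\partial p_i$. Repeated indices are summed. $C^\infty_{\rm pol}(T^*U)$ denotes the polynomials in $p_1,\dots,p_d$ with coefficients in $C^\infty(U)$, and $C^\infty_{\rm pol}(J^1T^*U)$ the polynomials in the jet coordinates $A_l$ and $\partial_kA_l$ with coefficients in $C^\infty(U)$; on the latter put $\partial_A^l=\partial/\partial A_l$ and $\partial_A^{k;l}=\partial/\partial(\partial_kA_l)$. Let $\theta=\frac12\theta^{ij}\partial_i\wedge\partial_j$ be an almost Poisson structure on $U$ (an arbitrary bivector field). Let a local symplectic embedding of $(U,\theta)$ be given by its formal Poisson bracket on $C^\infty_{\rm pol}(T^*U)[[t]]$, $$\{x^i,x^j\}=t\,\underline\theta^{ij},\qquad \{x^i,p_j\}=\delta^i_j+t\,\gamma^i_j,\qquad \{p_i,p_j\}=0,$$ where $\underline\theta^{ij}=-\underline\theta^{ji}$ and $\gamma^i_j$ lie in $C^\infty_{\rm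 pol}(T^*U)[[t]]$, the Jacobi identity holds, and $\underline\theta^{ij}|_{p=0}=\theta^{ij}$. For a one-form $A=A_i\,{\rm d}x^i$ on $U$ let $s_A^*$ be the substitution $p_i=A_i(x)$, let $\pi^*$ be the pullback along $\pi:T^*U\to U$, and put $(\Phi_A)_i=p_i-A_i$, $\Phi_A(V)=V^i(\Phi_A)_i$. Given $L^{ij}\in C^\infty_{\rm pol}(J^1T^*U)[[t]]$ and a function $h\in C^\infty(U)[[t]]$, put $L_h^i=t^2L^{ij}(x,A,\partial A)\,\partial_jh$, evaluated along $A$. For $f,g\in C^\infty(U)$ put $$\delta_fA_l=s_A^*\{\pi^*f+\Phi_A(L_f),(\Phi_A)_l\},\qquad h_{f,g}(A)=s_A^*\{\pi^*f,\pi^*g\}-s_A^*\{\Phi_A(L_f),\Phi_A(L_g)\},$$ $$\delta_fL_g^i=t^2\big(\partial_A^lL^{ij}\,\delta_fA_l+\partial_A^{k;l}L^{ij}\,\partial_k(\delta_fA_l)\big)\partial_jg .$$ The *recursion relations for the Lagrangian multipliers* are the equations, for all $f,g\in C^\infty(U)$, all one-forms $A$ on $U$ and all $i$, $$\begin{aligne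d}L^i_{h_{f,g}(A)}={}&\delta_fL_g^i-\delta_gL_f^i+s_A^*\big(\tilde\partial^i\{\pi^*f,\pi^*g\}\big)+L_f^jL_g^k\,s_A^*\big(\tilde\partial^i\{(\Phi_A)_j,(\Phi_A)_k\}\big)\\&+s_A^*\{\pi^*f,\pi^*L_g^i\}-s_A^*\{\pi^*g,\pi^*L_f^i\}+s_A^*\{\pi^*L_f^i,\Phi_A(L_g)\}-s_A^*\{\pi^*L_g^i,\Phi_A(L_f)\}\\&+L_g^j\,s_A^*\big(\tilde\partial^i\{\pi^*f,(\Phi_A)_j\}\big)-L_f^j\,s_A^*\big(\tilde\partial^i\{\pi^*g,(\Phi_A)_j\}\big).\end{aligned}$$ **Proposition.** Let $\Lambda^{ij}\in C^\infty_{\rm pol}(T^*U)[[t]]$, regarded as functions $\Lambda^{ij}(x,A)$ on the jet space which do not depend on $\partial A$, with $\partial_A^k=\tilde\partial^k$ under $p_k=A_k$, and let $$L^{ij}(A,\partial A)=\Lambda^{ij}+\sum_{n=1}^\infty(-t^2)^n\,\Lambda^{ik_1}\,\partial_{k_1}A_{m_1}\,\Lambda^{m_1k_2}\cdots\Lambda^{m_{n-1}k_n}\,\partial_{k_n}A_{m_n}\,\Lambda^{m_nj}.$$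 Then $L^{ij}\in C^\infty_{\rm pol}(J^1T^*U)[[t]]$ solves the recursion relations if and only if $\Lambda^{ij}$ satisfies the system of first order differential equations, for all $i,j,k$, $$\begin{aligned}&t\big(\partial_A^i\Lambda^{kj}-\partial_A^j\Lambda^{ki}\big)+t^3\big(\Lambda^{lj}\partial_l\Lambda^{ki}-\Lambda^{li}\partial_l\Lambda^{kj}\big)\\&\quad=-\partial_A^k\underline\theta^{ij}+t^2\big(\Lambda^{kl}\partial_l\underline\theta^{ij}+\Lambda^{li}\partial_A^k\gamma^j_l-\Lambda^{lj}\partial_A^k\gamma^i_l+\underline\theta^{jl}\partial_l\Lambda^{ki}-\underline\theta^{il}\partial_l\Lambda^{kj}+\gamma^j_l\partial_A^l\Lambda^{ki}-\gamma^i_l\partial_A^l\Lambda^{kj}\big)\\&\qquad+t^4\big(\gamma^l_m\Lambda^{mi}\partial_l\Lambda^{kj}-\gamma^l_m\Lambda^{mj}\partial_l\Lambda^{ki}+\Lambda^{kl}\Lambda^{mj}\partial_l\gamma^i_m-\Lambda^{kl}\Lambda^{mi}\partial_l\gamma^j_m\big),\end{aligned}$$ where $\partial_l$ is the derivative with respect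 to $x^l$ at fixed $A$. -/

import Mathlib

noncomputable section

namespace AlmostPoisson

/-! ## Function spaces

`U` is an open subset of `ℝᵈ` (a coordinate domain) and the ground field `𝕜` is `ℝ` or `ℂ`. -/

/-- The algebra `C^∞(U)` of smooth `𝕜`-valued functions on the open set `U ⊆ ℝᵈ`.
Smoothness is tested on the extension by zero, which on the open set `U` is the function itself. -/
def smoothFunctions (𝕜 : Type*) [RCLike 𝕜] {d : ℕ} (U : TopologicalSpace.Opens (Fin d → ℝ)) :
    Subalgebra 𝕜 (U → 𝕜) where
  carrier := {f | ContDiffOn ℝ ((⊤ : ℕ∞) : WithTop ℕ∞) (Function.extend Subtype.val f (0 : (Fin d → ℝ) → 𝕜)) (U : Set (Fin d → ℝ))}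
  mul_mem' := by
    intro f g hf hg
    refine (ContDiffOn.mul hf hg).congr fun x hx => ?_
    have e : ∀ h : U → 𝕜, Function.extend Subtype.val h (0 : (Fin d → ℝ) → 𝕜) x = h ⟨x, hx⟩ := fun h =>
      Subtype.val_injective.extend_apply h 0 ⟨x, hx⟩
    simp [e]
  add_mem' := by
    intro f g hf hg
    refine (ContDiffOn.add hf hg).congr fun x hx => ?_
    have e : ∀ h : U → 𝕜, Function.extend Subtype.val h (0 : (Fin d → ℝ) → 𝕜) x = h ⟨x, hx⟩ := fun h =>
      Subtype.val_injective.extend_apply h 0 ⟨x, hx⟩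
    simp [e]
  algebraMap_mem' := by
    intro c
    refine (contDiffOn_const (c := c)).congr fun x hx => ?_
    exact Subtype.val_injective.extend_apply _ (0 : (Fin d → ℝ) → 𝕜) (⟨x, hx⟩ : U)

/-- `C^∞(U)`. -/
def CInf (𝕜 : Type*) [RCLike 𝕜] {d : ℕ} (U : TopologicalSpace.Opens (Fin d → ℝ)) :=
  ↥(smoothFunctions 𝕜 U)

instance (𝕜 : Type*) [RCLike 𝕜] {d : ℕ} (U : TopologicalSpace.Opens (Fin d → ℝ)) :
    CommRing (CInf 𝕜 U) :=
  inferInstanceAs (CommRing ↥(smoothFunctions 𝕜 U))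

instance (𝕜 : Type*) [RCLike 𝕜] {d : ℕ} (U : TopologicalSpace.Opens (Fin d → ℝ)) :
    Algebra 𝕜 (CInf 𝕜 U) :=
  inferInstanceAs (Algebra 𝕜 ↥(smoothFunctions 𝕜 U))

/-- The functions on `T^*U` that are polynomial on the fibres: polynomials in the fibre
coordinates `p_0, …, p_{d-1}` with coefficients in `C^∞(U)`. -/
abbrev CotPol (𝕜 : Type*) [RCLike 𝕜] {d : ℕ} (U : TopologicalSpace.Opens (Fin d → ℝ)) :=
  MvPolynomial (Fin d) (CInf 𝕜 U)

/-- The functions on the first jet space `J¹T^*U` that are polynomial on the fibres over `U`: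
polynomials, with coefficients in `C^∞(U)`, in the fibre coordinates `A_l` (the variables `inl l`)
and `∂_k A_l` (the variables `inr (k, l)`). -/
abbrev JetPol (𝕜 : Type*) [RCLike 𝕜] {d : ℕ} (U : TopologicalSpace.Opens (Fin d → ℝ)) :=
  MvPolynomial (Fin d ⊕ Fin d × Fin d) (CInf 𝕜 U)

section Derivatives

variable {𝕜 : Type*} [RCLike 𝕜] {d : ℕ} {U : TopologicalSpace.Opens (Fin d → ℝ)}

/-- The partial derivative `∂_i = ∂/∂x^i` on `C^∞(U)`. -/
def partialX (i : Fin d) (f : CInf 𝕜 U) : CInf 𝕜 U :=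
  ⟨fun x => fderiv ℝ (Function.extend Subtype.val f.1 (0 : (Fin d → ℝ) → 𝕜)) (x : Fin d → ℝ) (Pi.single i 1), by
    have hf : ContDiffOn ℝ ((⊤ : ℕ∞) : WithTop ℕ∞) (Function.extend Subtype.val f.1 (0 : (Fin d → ℝ) → 𝕜)) (U : Set (Fin d → ℝ)) := f.2
    have h1 : ContDiffOn ℝ ((⊤ : ℕ∞) : WithTop ℕ∞) (fun x : Fin d → ℝ =>
        fderiv ℝ (Function.extend Subtype.val f.1 (0 : (Fin d → ℝ) → 𝕜)) x (Pi.single i 1)) (U : Set (Fin d → ℝ)) :=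
      (hf.fderiv_of_isOpen (m := ((⊤ : ℕ∞) : WithTop ℕ∞)) U.isOpen (by simp)).clm_apply contDiffOn_const
    exact h1.congr fun x hx => Subtype.val_injective.extend_apply _ (0 : (Fin d → ℝ) → 𝕜) (⟨x, hx⟩ : U)⟩

/-- Apply a map to every coefficient of a formal power series in `t`. -/
def coeffwise {R S : Type*} [Semiring R] [Semiring S] (D : R → S) (F : PowerSeries R) :
    PowerSeries S :=
  PowerSeries.mk fun n => D (PowerSeries.coeff n F)

/-- `∂_i = ∂/∂x^i` on `C^∞(U)[[t]]`. -/
def dBase (i : Fin d) (h : PowerSeries (CInf 𝕜 U)) : PowerSeries (CInf 𝕜 U) :=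
  coeffwise (partialX i) h

/-- `∂_i = ∂/∂x^i` (at fixed fibre coordinates) on `C_pol^∞(T^*U)[[t]]`. -/
def dX (i : Fin d) (F : PowerSeries (CotPol 𝕜 U)) : PowerSeries (CotPol 𝕜 U) :=
  coeffwise (fun P : CotPol 𝕜 U =>
    ∑ m ∈ P.support, MvPolynomial.monomial m (partialX i (P.coeff m))) F

/-- `∂/∂p_i` on `C_pol^∞(T^*U)[[t]]`. -/
def dP (i : Fin d) (F : PowerSeries (CotPol 𝕜 U)) : PowerSeries (CotPol 𝕜 U) :=
  coeffwise (MvPolynomial.pderiv i) F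

/-- `∂/∂A_l` on `C_pol^∞(J¹T^*U)[[t]]`. -/
def dA (l : Fin d) (F : PowerSeries (JetPol 𝕜 U)) : PowerSeries (JetPol 𝕜 U) :=
  coeffwise (MvPolynomial.pderiv (Sum.inl l)) F

/-- `∂/∂(∂_k A_l)` on `C_pol^∞(J¹T^*U)[[t]]`. -/
def dDA (k l : Fin d) (F : PowerSeries (JetPol 𝕜 U)) : PowerSeries (JetPol 𝕜 U) :=
  coeffwise (MvPolynomial.pderiv (Sum.inr (k, l))) F

/-- The pullback `π^*` along the cotangent projection `π : T^*U → U`. -/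
def pullBase (h : PowerSeries (CInf 𝕜 U)) : PowerSeries (CotPol 𝕜 U) :=
  PowerSeries.map (MvPolynomial.C : CInf 𝕜 U →+* CotPol 𝕜 U) h

/-- A function of `U`, regarded as a formal power series in `t`. -/
def const (f : CInf 𝕜 U) : PowerSeries (CInf 𝕜 U) := PowerSeries.C f

/-- The pullback `s_A^*` along the section `s_A(x) = (x, A(x))` of `T^*U` given by the one-form
`A = A_i dx^i`: substitute `p_i = A_i(x)`. -/
def pullSection (A : Fin d → CInf 𝕜 U) (F : PowerSeries (CotPol 𝕜 U)) :
    PowerSeries (CInf 𝕜 U) :=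
  PowerSeries.map (MvPolynomial.eval A) F

/-- The value `F(x, A(x), ∂A(x))` of a function on the jet space along the prolongation of `A`. -/
def pullJet (A : Fin d → CInf 𝕜 U) (F : PowerSeries (JetPol 𝕜 U)) : PowerSeries (CInf 𝕜 U) :=
  PowerSeries.map (MvPolynomial.eval
    (Sum.elim A fun kl : Fin d × Fin d => partialX kl.1 (A kl.2))) F

/-- The pullback `C_pol^∞(T^*U)[[t]] → C_pol^∞(J¹T^*U)[[t]]` along `J¹T^*U → T^*U`
(`p_l` becomes `A_l`). -/
def cotToJet (F : PowerSeries (CotPol 𝕜 U)) : PowerSeries (JetPol 𝕜 U) :=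
  PowerSeries.map (MvPolynomial.rename (R := CInf 𝕜 U) Sum.inl).toRingHom F

end Derivatives

/-! ## Almost Poisson structures and local symplectic embeddings -/

/-- An almost Poisson structure on `U`: a bivector field `θ = ½ θ^{ij} ∂_i ∧ ∂_j`
(with no condition on its Jacobiator). -/
structure AlmostPoissonStructure (𝕜 : Type*) [RCLike 𝕜] {d : ℕ}
    (U : TopologicalSpace.Opens (Fin d → ℝ)) where
  comp : Fin d → Fin d → CInf 𝕜 U
  skew : ∀ i j, comp i j = -comp j i

section Brackets

variable {𝕜 : Type*} [RCLike 𝕜] {d : ℕ} {U : TopologicalSpace.Opens (Fin d → ℝ)}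

/-- The bracket on `C_pol^∞(T^*U)[[t]]` determined by
`{x^i, x^j} = t Θ^{ij}`, `{x^i, p_j} = δ^i_j + t γ^i_j`, `{p_i, p_j} = 0`,
where `Th i j` is `Θ^{ij}(x, p)` and `ga i j` is `γ^i_j(x, p)` (upper index first). -/
def bracketOf (Th ga : Fin d → Fin d → PowerSeries (CotPol 𝕜 U))
    (F G : PowerSeries (CotPol 𝕜 U)) : PowerSeries (CotPol 𝕜 U) :=
  PowerSeries.X * (∑ i, ∑ j, Th i j * dX i F * dX j G) +
    ∑ i, ∑ j, ((if i = j then 1 else 0) + PowerSeries.X * ga i j) *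
      (dX i F * dP j G - dP j F * dX i G)

/-- A local symplectic embedding of `(U, θ)`, presented by its formal Poisson (cosymplectic)
bivector `ω⁻¹` on `T^*U`, with `{x^i, x^j} = t Θ^{ij}`, `{x^i, p_j} = δ^i_j + t γ^i_j` and
`{p_i, p_j} = 0`.  Because of this form, `ω⁻¹` reduces to the canonical bivector at `t = 0` (so that
it is formally nondegenerate) and the zero section is Lagrangian. -/
structure LocalSymplecticEmbedding (θ : AlmostPoissonStructure 𝕜 U) where
  /-- the components `Θ^{ij}(x, p)` -/
  Th : Fin d → Fin d → PowerSeries (CotPol 𝕜 U)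
  /-- the components `γ^i_j(x, p)`, upper index first -/
  ga : Fin d → Fin d → PowerSeries (CotPol 𝕜 U)
  skew : ∀ i j, Th i j = -Th j i
  /-- on the zero section `p = 0` the bracket of functions of `x` is `t` times the bracket of `θ` -/
  zeroSection : ∀ i j, pullSection (fun _ => 0) (Th i j) = const (θ.comp i j)
  /-- the Poisson integrability condition `[ω⁻¹, ω⁻¹] = 0` -/
  jacobi : ∀ F G H : PowerSeries (CotPol 𝕜 U),
    bracketOf Th ga F (bracketOf Th ga G H) + bracketOf Th ga G (bracketOf Th ga H F) +
      bracketOf Th ga H (bracketOf Th ga F G) = 0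

variable {θ : AlmostPoissonStructure 𝕜 U}

/-- The cosymplectic bracket `{F, G}_{ω⁻¹}`. -/
def LocalSymplecticEmbedding.bracket (Ω : LocalSymplecticEmbedding θ)
    (F G : PowerSeries (CotPol 𝕜 U)) : PowerSeries (CotPol 𝕜 U) :=
  bracketOf Ω.Th Ω.ga F G

/-! ## The recursion relations for the Lagrangian multipliers -/

/-- The constraint `(Φ_A)_i = p_i - A_i(x)` on `T^*U`. -/
def Phi (A : Fin d → CInf 𝕜 U) (i : Fin d) : PowerSeries (CotPol 𝕜 U) :=
  PowerSeries.C (MvPolynomial.X i) - pullBase (const (A i))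

/-- `Φ_A(V) = V^i (Φ_A)_i` for a horizontal vector field `V = V^i ∂_i`. -/
def PhiV (A : Fin d → CInf 𝕜 U) (V : Fin d → PowerSeries (CInf 𝕜 U)) :
    PowerSeries (CotPol 𝕜 U) :=
  ∑ i, pullBase (V i) * Phi A i

/-- The components along `A` of the vector field `L_h = t² L^{ij}(x, A, ∂A) ∂_j h ∂_i`. -/
def mult (L : Fin d → Fin d → PowerSeries (JetPol 𝕜 U)) (A : Fin d → CInf 𝕜 U)
    (h : PowerSeries (CInf 𝕜 U)) (i : Fin d) : PowerSeries (CInf 𝕜 U) :=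
  PowerSeries.X ^ 2 * ∑ j, pullJet A (L i j) * dBase j h

/-- The gauge variation `δ_f A = s_A^*{π^*f + Φ_A(L_f), Φ_A}`, in components. -/
def gaugeVar (Ω : LocalSymplecticEmbedding θ) (L : Fin d → Fin d → PowerSeries (JetPol 𝕜 U))
    (A : Fin d → CInf 𝕜 U) (f : CInf 𝕜 U) (l : Fin d) : PowerSeries (CInf 𝕜 U) :=
  pullSection A (Ω.bracket (pullBase (const f) + PhiV A (mult L A (const f))) (Phi A l))

/-- The field dependent gauge parameter
`t ⟦f,g⟧(A) = s_A^*{π^*f, π^*g} - s_A^*{Φ_A(L_f), Φ_A(L_g)}`. -/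
def tFieldBracket (Ω : LocalSymplecticEmbedding θ)
    (L : Fin d → Fin d → PowerSeries (JetPol 𝕜 U))
    (A : Fin d → CInf 𝕜 U) (f g : CInf 𝕜 U) : PowerSeries (CInf 𝕜 U) :=
  pullSection A (Ω.bracket (pullBase (const f)) (pullBase (const g))) -
    pullSection A (Ω.bracket (PhiV A (mult L A (const f))) (PhiV A (mult L A (const g))))

/-- The gauge variation `δ_f L_g^i` at `A`: the first order variation of
`L_g^i = t² L^{ij}(x, A, ∂A) ∂_j g` under `A ↦ A + δ_f A`, `∂A ↦ ∂A + ∂(δ_f A)`. -/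
def varMult (Ω : LocalSymplecticEmbedding θ) (L : Fin d → Fin d → PowerSeries (JetPol 𝕜 U))
    (A : Fin d → CInf 𝕜 U) (f g : CInf 𝕜 U) (i : Fin d) : PowerSeries (CInf 𝕜 U) :=
  PowerSeries.X ^ 2 * ∑ j,
    ((∑ l, pullJet A (dA l (L i j)) * gaugeVar Ω L A f l) +
      ∑ k, ∑ l, pullJet A (dDA k l (L i j)) * dBase k (gaugeVar Ω L A f l)) *
        dBase j (const g)

/-- The functions `L^{ij}` on the jet space solve the recursion relations for Lagrangian
multipliers: the relations hold for all gauge parameters `f, g ∈ C^∞(U)`, all gauge fields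
`A ∈ Ω¹(U)` and all components `i`. -/
def SolvesRecursion (Ω : LocalSymplecticEmbedding θ)
    (L : Fin d → Fin d → PowerSeries (JetPol 𝕜 U)) : Prop :=
  ∀ (f g : CInf 𝕜 U) (A : Fin d → CInf 𝕜 U) (i : Fin d),
    let f' := pullBase (const f)
    let g' := pullBase (const g)
    let Lf := mult L A (const f)
    let Lg := mult L A (const g)
    mult L A (tFieldBracket Ω L A f g) i =
      varMult Ω L A f g i - varMult Ω L A g f i
      + pullSection A (dP i (Ω.bracket f' g'))
      + (∑ j, ∑ k, Lf j * Lg k * pullSection A (dP i (Ω.bracket (Phi A j) (Phi A k))))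
      + pullSection A (Ω.bracket f' (pullBase (Lg i)))
      - pullSection A (Ω.bracket g' (pullBase (Lf i)))
      + pullSection A (Ω.bracket (pullBase (Lf i)) (PhiV A Lg))
      - pullSection A (Ω.bracket (pullBase (Lg i)) (PhiV A Lf))
      + (∑ j, Lg j * pullSection A (dP i (Ω.bracket f' (Phi A j))))
      - (∑ j, Lf j * pullSection A (dP i (Ω.bracket g' (Phi A j))))

/-! ## The geometric series and the differential system -/

/-- The term
`(-t²)ⁿ Λ^{i k₁} ∂_{k₁}A_{m₁} Λ^{m₁ k₂} ⋯ Λ^{m_{n-1} k_n} ∂_{k_n}A_{m_n} Λ^{m_n j}`,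
with the summation over the repeated indices written as a product of matrices. -/
def seriesTerm (Λ : Fin d → Fin d → PowerSeries (CotPol 𝕜 U)) (n : ℕ) (i j : Fin d) :
    PowerSeries (JetPol 𝕜 U) :=
  let M : Matrix (Fin d) (Fin d) (PowerSeries (JetPol 𝕜 U)) :=
    Matrix.of fun a b => cotToJet (Λ a b)
  let J : Matrix (Fin d) (Fin d) (PowerSeries (JetPol 𝕜 U)) :=
    Matrix.of fun k m => PowerSeries.C (MvPolynomial.X (Sum.inr (k, m)))
  (-PowerSeries.X ^ 2) ^ n * (M * (J * M) ^ n) i j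

/-- `L^{ij} = Λ^{ij} + ∑_{n ≥ 1} (n-th term)`.  The `n`-th term is divisible by `t^{2n}`, so that
only the terms with `n ≤ N` contribute to the coefficient of `t^N`. -/
def seriesL (Λ : Fin d → Fin d → PowerSeries (CotPol 𝕜 U)) (i j : Fin d) :
    PowerSeries (JetPol 𝕜 U) :=
  cotToJet (Λ i j) +
    PowerSeries.mk fun N => ∑ n ∈ Finset.Icc 1 N, PowerSeries.coeff N (seriesTerm Λ n i j)

/-- The system of first order differential equations for functions `Λ^{ij}(x, A)` that do not
depend on `∂A`; here `∂/∂A_k` is `dP k`, and `Ω.ga i j` is `γ^i_j`. -/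
def DiffSystem (Ω : LocalSymplecticEmbedding θ)
    (Λ : Fin d → Fin d → PowerSeries (CotPol 𝕜 U)) : Prop :=
  ∀ i j k : Fin d,
    PowerSeries.X * (dP i (Λ k j) - dP j (Λ k i))
      + PowerSeries.X ^ 3 * (∑ l, (Λ l j * dX l (Λ k i) - Λ l i * dX l (Λ k j))) =
    -dP k (Ω.Th i j)
      + PowerSeries.X ^ 2 * (∑ l,
          (Λ k l * dX l (Ω.Th i j)
            + Λ l i * dP k (Ω.ga j l) - Λ l j * dP k (Ω.ga i l)
            + Ω.Th j l * dX l (Λ k i) - Ω.Th i l * dX l (Λ k j)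
            + Ω.ga j l * dP l (Λ k i) - Ω.ga i l * dP l (Λ k j)))
      + PowerSeries.X ^ 4 * (∑ l, ∑ m,
          (Ω.ga l m * Λ m i * dX l (Λ k j) - Ω.ga l m * Λ m j * dX l (Λ k i)
            + Λ k l * Λ m j * dX l (Ω.ga i m) - Λ k l * Λ m i * dX l (Ω.ga j m)))

end Brackets

end AlmostPoisson

end

/-! Fix a one-form A and write J for the matrix of the ∂_k A_m, l for t²Λ and K for t²L along A. The
geometric series is the resolvent identity K + KJl = l. Hence 1 - JK is invertible with inverse 1 +
Jl, 1 - KJ is invertible with inverse 1 + lJ, and K = l(1 - JK). The gradient along s_A of π^*f +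
Φ_A(L_f) is therefore (q, v) with q = (1 - JK)df and v = K df = lq: the dressed covectors lie on the
graph of l, whatever J is.

Differentiating the resolvent identity gives K' = (1 - KJ) l' (1 - JK) - K J' K, both for the
derivatives ∂_k along A and for the variation of A (`resolvent_derivative`). Substituted into the
recursion relations, it makes all explicit J cancel up to an invertible factor: right side minus
left side equals (1 - KJ) applied to a vector `defect` built only from l, the bivector and their x-
and p-derivatives (`recursion_sub_eq_defect`). The cancellation rests on the symmetry of second
derivatives of A, f and g and on the skew-symmetry of the bivector.

On the graph of l the k-th component of this vector is a bilinear form in the two horizontal parts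
q. Its matrix is t times the pullback by s_A of the difference of the two sides of the differential
system (`defectMatrix_apply`). If the system holds, the defect vanishes. Conversely, the
differentials of coordinate functions form a basis, so the invertibility of 1 - KJ and 1 - JK forces
the matrix to vanish for every A. A polynomial in p that vanishes on all one-forms, even the
constant ones, is zero, and t can be cancelled. -/

noncomputable section

namespace AlmostPoisson

/-! ### Derivations extended coefficientwise to polynomials and power series. -/

section Coeffwise

variable {R S : Type*} [CommRing R] [CommRing S]

theorem coeffwise_mul_of_leibniz (φ : R →+* S) (D : R →+ S)
    (hD : ∀ a b, D (a * b) = φ a * D b + φ b * D a) (F G : PowerSeries R) :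
    coeffwise D (F * G) =
      PowerSeries.map φ F * coeffwise D G + PowerSeries.map φ G * coeffwise D F := by
  ext n
  simp only [coeffwise, PowerSeries.coeff_mk, PowerSeries.coeff_mul, map_add, map_sum, hD,
    PowerSeries.coeff_map, Finset.sum_add_distrib]
  congr 1
  rw [← Finset.Nat.sum_antidiagonal_swap]
  rfl

theorem coeffwise_add (D : R →+ S) (F G : PowerSeries R) :
    coeffwise D (F + G) = coeffwise D F + coeffwise D G := by
  ext n
  simp [coeffwise]

theorem coeffwise_C (D : R →+ S) (a : R) :
    coeffwise D (PowerSeries.C a) = PowerSeries.C (D a) := by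
  ext n
  simp only [coeffwise, PowerSeries.coeff_mk, PowerSeries.coeff_C]
  split <;> simp

theorem coeffwise_X_pow (D : R →+ S) (h1 : D 1 = 0) (n : ℕ) :
    coeffwise D ((PowerSeries.X : PowerSeries R) ^ n) = 0 := by
  ext m
  simp only [coeffwise, PowerSeries.coeff_mk, PowerSeries.coeff_X_pow]
  split <;> simp [h1]

/-- The extension of a derivation of `R` to the formal power series over `R`, coefficient by
coefficient. -/
def coeffDer (D : Derivation ℤ R R) : Derivation ℤ (PowerSeries R) (PowerSeries R) :=
  Derivation.mk'
    (AddMonoidHom.toIntLinearMap (AddMonoidHom.mk' (coeffwise D)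
      (coeffwise_add (D : R →ₗ[ℤ] R).toAddMonoidHom))) (fun F G => by
    have := coeffwise_mul_of_leibniz (RingHom.id R) (D : R →ₗ[ℤ] R).toAddMonoidHom
      (fun a b => by simp) F G
    rw [PowerSeries.map_id] at this
    exact this)

theorem coeffDer_apply (D : Derivation ℤ R R) (F : PowerSeries R) :
    coeffDer D F = coeffwise D F := rfl

theorem coeffDer_C (D : Derivation ℤ R R) (a : R) :
    coeffDer D (PowerSeries.C a) = PowerSeries.C (D a) :=
  coeffwise_C (D : R →ₗ[ℤ] R).toAddMonoidHom a

theorem coeffDer_X (D : Derivation ℤ R R) : coeffDer D (PowerSeries.X : PowerSeries R) = 0 := by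
  simpa [coeffDer_apply] using coeffwise_X_pow (D : R →ₗ[ℤ] R).toAddMonoidHom (by simp) 1

theorem coeffDer_X_pow_mul (D : Derivation ℤ R R) (n : ℕ) (F : PowerSeries R) :
    coeffDer D (PowerSeries.X ^ n * F) = PowerSeries.X ^ n * coeffDer D F := by
  simp [Derivation.leibniz, coeffDer_X, Derivation.leibniz_pow]

theorem coeff_sum_support_monomial {σ : Type*} (D : R → R) (h0 : D 0 = 0)
    (P : MvPolynomial σ R) (m : σ →₀ ℕ) :
    MvPolynomial.coeff m (∑ n ∈ P.support, MvPolynomial.monomial n (D (P.coeff n))) =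
      D (P.coeff m) := by
  classical
  simp only [MvPolynomial.coeff_sum, MvPolynomial.coeff_monomial, Finset.sum_ite_eq']
  split
  · rfl
  · rename_i h
    rw [MvPolynomial.notMem_support_iff.mp h, h0]

/-- The extension of a derivation of `R` to the polynomials over `R`, coefficient by
coefficient. -/
def polyDer {σ : Type*} (D : Derivation ℤ R R) :
    Derivation ℤ (MvPolynomial σ R) (MvPolynomial σ R) :=
  Derivation.mk'
    (AddMonoidHom.toIntLinearMap (AddMonoidHom.mk'
      (fun P : MvPolynomial σ R => ∑ n ∈ P.support, MvPolynomial.monomial n (D (P.coeff n)))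
      (fun P Q => by
        ext m
        rw [MvPolynomial.coeff_add]
        simp only [coeff_sum_support_monomial D (map_zero D)]
        rw [MvPolynomial.coeff_add, map_add])))
    (fun P Q => by
      classical
      ext m
      simp only [AddMonoidHom.coe_toIntLinearMap, AddMonoidHom.mk'_apply, smul_eq_mul]
      rw [MvPolynomial.coeff_add, coeff_sum_support_monomial D (map_zero D),
        MvPolynomial.coeff_mul, MvPolynomial.coeff_mul, MvPolynomial.coeff_mul]
      simp only [coeff_sum_support_monomial D (map_zero D), map_sum, Derivation.leibniz,
        smul_eq_mul, Finset.sum_add_distrib]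
      congr 1
      refine Finset.sum_nbij' Prod.swap Prod.swap ?_ ?_ ?_ ?_ ?_ <;>
        simp [add_comm])

theorem coeff_polyDer {σ : Type*} (D : Derivation ℤ R R) (P : MvPolynomial σ R) (m : σ →₀ ℕ) :
    MvPolynomial.coeff m (polyDer D P) = D (MvPolynomial.coeff m P) :=
  coeff_sum_support_monomial D (map_zero D) P m

theorem polyDer_C {σ : Type*} (D : Derivation ℤ R R) (a : R) :
    polyDer D (MvPolynomial.C a : MvPolynomial σ R) = MvPolynomial.C (D a) := by
  classical
  ext m
  rw [coeff_polyDer]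
  simp only [MvPolynomial.coeff_C]
  split <;> simp

theorem polyDer_X {σ : Type*} (D : Derivation ℤ R R) (i : σ) :
    polyDer D (MvPolynomial.X i : MvPolynomial σ R) = 0 := by
  classical
  ext m
  rw [coeff_polyDer]
  simp only [MvPolynomial.coeff_X]
  split <;> simp

/-- The chain rule for p = A(x). Both sides are additive in P and compatible with multiplication by
a variable, so constants and that induction step suffice. -/
theorem der_eval {σ : Type*} [Fintype σ] (D : Derivation ℤ R R) (A : σ → R)
    (P : MvPolynomial σ R) :
    D (MvPolynomial.eval A P) = MvPolynomial.eval A (polyDer D P) +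
      ∑ m, D (A m) * MvPolynomial.eval A (MvPolynomial.pderiv m P) := by
  classical
  induction P using MvPolynomial.induction_on with
  | C a => simp [polyDer_C]
  | add p q hp hq =>
    simp only [map_add, hp, hq, mul_add, Finset.sum_add_distrib]
    ring
  | mul_X p i hp =>
    simp only [map_mul, Derivation.leibniz, hp, smul_eq_mul, MvPolynomial.eval_X, map_add,
      polyDer_X, MvPolynomial.pderiv_X, mul_add, Finset.sum_add_distrib]
    have h1 : ∑ m, D (A m) * (MvPolynomial.eval A p *
        MvPolynomial.eval A ((Pi.single m 1 : σ → MvPolynomial σ R) i)) =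
        MvPolynomial.eval A p * D (A i) := by
      rw [Finset.sum_eq_single i]
      · simp [mul_comm]
      · intro b _ hb
        simp [hb.symm]
      · simp
    rw [h1, Finset.mul_sum]
    simp only [mul_zero, map_zero, zero_add]
    simp only [mul_left_comm (A i)]
    ring

theorem der_eval_coeffwise {σ : Type*} [Fintype σ] (D : Derivation ℤ R R) (A : σ → R)
    (F : PowerSeries (MvPolynomial σ R)) :
    coeffDer D (PowerSeries.map (MvPolynomial.eval A) F) =
      PowerSeries.map (MvPolynomial.eval A) (coeffDer (polyDer D) F) +
      ∑ m, PowerSeries.C (D (A m)) * PowerSeries.map (MvPolynomial.eval A)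
        (coeffwise (MvPolynomial.pderiv m) F) := by
  ext n
  simp only [show coeffDer (polyDer D) F = coeffwise (polyDer D) F from rfl, coeffDer_apply,
    coeffwise, PowerSeries.coeff_mk, PowerSeries.coeff_map, der_eval, map_add, map_sum,
    PowerSeries.coeff_C_mul]

end Coeffwise

/-! ### Smooth functions on the open set: partial derivatives, coordinates, separation by one-forms.
-/

section Smooth

variable {𝕜 : Type*} [RCLike 𝕜] {d : ℕ} {U : TopologicalSpace.Opens (Fin d → ℝ)}

/-- The extension by zero of a smooth function. -/
def extendZero (f : CInf 𝕜 U) : (Fin d → ℝ) → 𝕜 :=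
  Function.extend Subtype.val f.1 (0 : (Fin d → ℝ) → 𝕜)

theorem extendZero_apply (f : CInf 𝕜 U) (x : U) : extendZero f x = f.1 x :=
  Subtype.val_injective.extend_apply _ _ x

theorem contDiffAt_extendZero (f : CInf 𝕜 U) (x : U) :
    ContDiffAt ℝ ((⊤ : ℕ∞) : WithTop ℕ∞) (extendZero f) x :=
  ContDiffOn.contDiffAt (s := (U : Set (Fin d → ℝ))) f.2 (U.isOpen.mem_nhds x.2)

theorem differentiableAt_extendZero (f : CInf 𝕜 U) (x : U) :
    DifferentiableAt ℝ (extendZero f) x :=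
  (contDiffAt_extendZero f x).differentiableAt (by simp)

theorem CInf.ext {f g : CInf 𝕜 U} (h : ∀ x, f.1 x = g.1 x) : f = g :=
  Subtype.ext (funext h)

theorem CInf.add_val (f g : CInf 𝕜 U) : (f + g).1 = f.1 + g.1 := rfl

theorem CInf.mul_val (f g : CInf 𝕜 U) : (f * g).1 = f.1 * g.1 := rfl

theorem CInf.zero_val : (0 : CInf 𝕜 U).1 = 0 := rfl

theorem CInf.one_val : (1 : CInf 𝕜 U).1 = 1 := rfl

theorem extendZero_add (f g : CInf 𝕜 U) : extendZero (f + g) = extendZero f + extendZero g := by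
  simp only [extendZero, CInf.add_val, ← Function.extend_add, add_zero]

theorem extendZero_mul (f g : CInf 𝕜 U) : extendZero (f * g) = extendZero f * extendZero g := by
  simp only [extendZero, CInf.mul_val, ← Function.extend_mul, mul_zero]

theorem partialX_val (i : Fin d) (f : CInf 𝕜 U) (x : U) :
    (partialX i f).1 x = fderiv ℝ (extendZero f) x (Pi.single i 1) := rfl

/-- The partial derivative `∂_i` as a derivation of `C^∞(U)`. -/
def derX (i : Fin d) : Derivation ℤ (CInf 𝕜 U) (CInf 𝕜 U) :=
  Derivation.mk' (AddMonoidHom.toIntLinearMap (AddMonoidHom.mk' (partialX i) (fun f g => by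
    refine CInf.ext fun x => ?_
    simp only [CInf.add_val, Pi.add_apply, partialX_val, extendZero_add]
    rw [fderiv_add (differentiableAt_extendZero f x) (differentiableAt_extendZero g x)]
    rfl))) (fun f g => by
    refine CInf.ext fun x => ?_
    simp only [AddMonoidHom.coe_toIntLinearMap, AddMonoidHom.mk'_apply, smul_eq_mul,
      CInf.add_val, CInf.mul_val, Pi.add_apply, Pi.mul_apply, partialX_val, extendZero_mul]
    rw [fderiv_mul (differentiableAt_extendZero f x) (differentiableAt_extendZero g x)]
    simp [extendZero_apply])

theorem partialX_comm (i j : Fin d) (f : CInf 𝕜 U) :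
    partialX i (partialX j f) = partialX j (partialX i f) := by
  refine CInf.ext fun x => ?_
  have key : ∀ a b : Fin d, (partialX a (partialX b f)).1 x =
      fderiv ℝ (fderiv ℝ (extendZero f)) x (Pi.single a 1) (Pi.single b 1) := by
    intro a b
    rw [partialX_val]
    -- The extension by zero of the derivative is controlled only on U, so the identification holds
    -- near x and not globally.
    have h1 : extendZero (partialX b f) =ᶠ[nhds (x : Fin d → ℝ)]
        fun y => fderiv ℝ (extendZero f) y (Pi.single b 1) := by
      filter_upwards [U.isOpen.mem_nhds x.2] with y hy
      exact extendZero_apply (partialX b f) ⟨y, hy⟩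
    have h2 : DifferentiableAt ℝ (fderiv ℝ (extendZero f)) x :=
      ((contDiffAt_extendZero f x).fderiv_right (m := ((⊤ : ℕ∞) : WithTop ℕ∞)) (by simp)).differentiableAt (by simp)
    rw [h1.fderiv_eq, fderiv_clm_apply h2 (differentiableAt_const _)]
    simp
  rw [key, key]
  exact ((contDiffAt_extendZero f x).isSymmSndFDerivAt
    (by simpa using WithTop.coe_le_coe.mpr (le_top (a := (2 : ℕ∞))))).eq _ _

/-- The coordinate function `x^c` on `U`. -/
def coordFun (c : Fin d) : CInf 𝕜 U :=
  ⟨fun x => ((x : Fin d → ℝ) c : 𝕜), by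
    have h : ContDiffOn ℝ ((⊤ : ℕ∞) : WithTop ℕ∞) (fun x : Fin d → ℝ => ((x c : ℝ) : 𝕜))
        (U : Set (Fin d → ℝ)) :=
      ((RCLike.ofRealCLM (K := 𝕜)).contDiff.comp (contDiff_apply ℝ ℝ c)).contDiffOn
    exact h.congr fun x hx =>
      Subtype.val_injective.extend_apply _ (0 : (Fin d → ℝ) → 𝕜) (⟨x, hx⟩ : U)⟩

theorem partialX_coordFun (i c : Fin d) :
    partialX i (coordFun c : CInf 𝕜 U) = if i = c then 1 else 0 := by
  refine CInf.ext fun x => ?_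
  have h1 : extendZero (coordFun c : CInf 𝕜 U) =ᶠ[nhds (x : Fin d → ℝ)]
      (RCLike.ofRealCLM (K := 𝕜)).comp (ContinuousLinearMap.proj (R := ℝ) (φ := fun _ => ℝ) c) := by
    filter_upwards [U.isOpen.mem_nhds x.2] with y hy
    exact extendZero_apply (coordFun c) ⟨y, hy⟩
  rw [partialX_val, h1.fderiv_eq, ContinuousLinearMap.fderiv]
  by_cases h : i = c
  · subst h
    simp [CInf.one_val]
  · simp [h, CInf.zero_val, Ne.symm h]

/-- A scalar, as a constant function. -/
def constFun (c : 𝕜) : CInf 𝕜 U := algebraMap 𝕜 (CInf 𝕜 U) c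

/-- Evaluation of smooth functions at a point. -/
def evalAt (x : U) : CInf 𝕜 U →+* 𝕜 where
  toFun f := f.1 x
  map_one' := rfl
  map_mul' _ _ := rfl
  map_zero' := rfl
  map_add' _ _ := rfl

theorem evalAt_constFun (x : U) (c : 𝕜) : evalAt x (constFun c) = c := rfl

/-- Constant one-forms already suffice: at a fixed x the polynomial has coefficients in the infinite
field 𝕜 and vanishes at every point of 𝕜^d, so all its coefficients vanish at x. -/
theorem cotPol_eq_zero_of_eval (P : CotPol 𝕜 U)
    (h : ∀ A : Fin d → CInf 𝕜 U, MvPolynomial.eval A P = 0) : P = 0 := by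
  ext m
  refine CInf.ext fun x => ?_
  have h0 : MvPolynomial.map (evalAt x) P = 0 := by
    refine MvPolynomial.funext fun a => ?_
    have := congrArg (evalAt x) (h fun i => constFun (a i))
    rw [map_zero, MvPolynomial.eval_eq', map_sum] at this
    rw [map_zero, MvPolynomial.eval_map, MvPolynomial.eval₂_eq']
    simpa [evalAt_constFun] using this
  have := congrArg (MvPolynomial.coeff m) h0
  rw [MvPolynomial.coeff_map, MvPolynomial.coeff_zero] at this
  rw [MvPolynomial.coeff_zero]
  exact this

theorem eq_zero_of_pullSection (F : PowerSeries (CotPol 𝕜 U))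
    (h : ∀ A : Fin d → CInf 𝕜 U, pullSection A F = 0) : F = 0 := by
  ext1 n
  refine cotPol_eq_zero_of_eval _ fun A => ?_
  simpa [pullSection] using congrArg (PowerSeries.coeff n) (h A)

end Smooth

/-! ### The geometric series and its resolvent identity on the jet space. -/

section Series

variable {𝕜 : Type*} [RCLike 𝕜] {d : ℕ} {U : TopologicalSpace.Opens (Fin d → ℝ)}

/-- Telescoping, with the remainder kept explicit so that it can be discarded t-adically. -/
theorem sum_geometric_mul {R : Type*} [CommRing R] {ι : Type*} [Fintype ι] [DecidableEq ι]
    (M J : Matrix ι ι R) (c : R) (N : ℕ) :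
    (∑ n ∈ Finset.range N, (-c) ^ n • (M * (J * M) ^ n)) * (1 + c • (J * M)) =
      M - (-c) ^ N • (M * (J * M) ^ N) := by
  induction N with
  | zero => simp
  | succ N ih =>
    rw [Finset.sum_range_succ, add_mul, ih, mul_add, mul_one, Matrix.smul_mul, Matrix.mul_smul,
      Matrix.mul_assoc, ← pow_succ, smul_smul, pow_succ (-c)]
    module

/-- `Λ` as a matrix of functions on the jet space. -/
def jetMat (Λ : Fin d → Fin d → PowerSeries (CotPol 𝕜 U)) :
    Matrix (Fin d) (Fin d) (PowerSeries (JetPol 𝕜 U)) :=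
  Matrix.of fun a b => cotToJet (Λ a b)

variable (𝕜 U) in
/-- The matrix of the jet coordinates `∂_k A_m`. -/
def jetJ : Matrix (Fin d) (Fin d) (PowerSeries (JetPol 𝕜 U)) :=
  Matrix.of fun k m => PowerSeries.C (MvPolynomial.X (Sum.inr (k, m)))

theorem seriesTerm_eq (Λ : Fin d → Fin d → PowerSeries (CotPol 𝕜 U)) (n : ℕ) (i j : Fin d) :
    seriesTerm Λ n i j = ((-(PowerSeries.X : PowerSeries (JetPol 𝕜 U)) ^ 2) ^ n •
      (jetMat Λ * (jetJ 𝕜 U * jetMat Λ) ^ n)) i j := rfl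

theorem coeff_seriesTerm_of_lt (Λ : Fin d → Fin d → PowerSeries (CotPol 𝕜 U)) {n N : ℕ}
    (h : N < n) (i j : Fin d) : PowerSeries.coeff N (seriesTerm Λ n i j) = 0 := by
  have hdvd : (PowerSeries.X : PowerSeries (JetPol 𝕜 U)) ^ n ∣ seriesTerm Λ n i j := by
    refine Dvd.dvd.mul_right ?_ _
    rw [neg_pow, ← pow_mul]
    exact Dvd.dvd.mul_left (pow_dvd_pow _ (by omega)) _
  exact PowerSeries.X_pow_dvd_iff.mp hdvd N h

/-- The number of terms can be any B > N, the surplus ones having no coefficient at t^N. One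
truncation then serves all coefficients below B at once. -/
theorem coeff_seriesL (Λ : Fin d → Fin d → PowerSeries (CotPol 𝕜 U)) {B N : ℕ} (h : N < B)
    (i j : Fin d) : PowerSeries.coeff N (seriesL Λ i j) =
      PowerSeries.coeff N (∑ n ∈ Finset.range B, seriesTerm Λ n i j) := by
  have h0 : seriesTerm Λ 0 i j = cotToJet (Λ i j) := by simp [seriesTerm]
  have h1 : Finset.range B = insert 0 (Finset.Icc 1 N) ∪ Finset.Ico (N + 1) B := by
    ext a
    simp only [Finset.mem_range, Finset.mem_union, Finset.mem_insert, Finset.mem_Icc,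
      Finset.mem_Ico]
    omega
  have h2 : Disjoint (insert 0 (Finset.Icc 1 N)) (Finset.Ico (N + 1) B) := by
    rw [Finset.disjoint_left]
    intro a
    simp only [Finset.mem_insert, Finset.mem_Icc, Finset.mem_Ico]
    omega
  rw [map_sum, h1, Finset.sum_union h2, Finset.sum_insert (by simp), h0, seriesL, map_add,
    PowerSeries.coeff_mk, Finset.sum_eq_zero (s := Finset.Ico (N + 1) B), add_zero]
  intro a ha
  exact coeff_seriesTerm_of_lt Λ (by simp only [Finset.mem_Ico] at ha; omega) i j

/-- The closed form of the series, and all that is used about it afterwards. At the coefficient of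
t^N, the series is replaced by its partial sum with N + 1 terms; the error and the telescoping
remainder are both divisible by t^(N+1). -/
theorem seriesL_add_mul (Λ : Fin d → Fin d → PowerSeries (CotPol 𝕜 U)) :
    Matrix.of (seriesL Λ) + (PowerSeries.X : PowerSeries (JetPol 𝕜 U)) ^ 2 •
      (Matrix.of (seriesL Λ) * jetJ 𝕜 U * jetMat Λ) = jetMat Λ := by
  set c : PowerSeries (JetPol 𝕜 U) := PowerSeries.X ^ 2 with hc
  set M := jetMat Λ with hM
  set J := jetJ 𝕜 U with hJ
  ext1 i j
  ext1 N
  set B := N + 1 with hB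
  set S := ∑ n ∈ Finset.range B, (-c) ^ n • (M * (J * M) ^ n) with hS
  have hSL : ∀ a b, ∃ r, Matrix.of (seriesL Λ) a b = S a b + PowerSeries.X ^ B * r := by
    intro a b
    have : (PowerSeries.X : PowerSeries (JetPol 𝕜 U)) ^ B ∣ seriesL Λ a b - S a b := by
      rw [PowerSeries.X_pow_dvd_iff]
      intro n hn
      rw [map_sub, coeff_seriesL Λ hn, hS, Matrix.sum_apply]
      simp only [seriesTerm_eq]
      exact sub_self _
    obtain ⟨r, hr⟩ := this
    exact ⟨r, by rw [Matrix.of_apply, ← hr]; ring⟩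
  choose r hr using hSL
  have hL : Matrix.of (seriesL Λ) = S + (PowerSeries.X : PowerSeries (JetPol 𝕜 U)) ^ B •
      Matrix.of r := by
    ext1 a b
    rw [hr]
    rfl
  have hgeo := sum_geometric_mul M J c B
  rw [← hS] at hgeo
  have key : Matrix.of (seriesL Λ) + c • (Matrix.of (seriesL Λ) * J * M) =
      M + (PowerSeries.X : PowerSeries (JetPol 𝕜 U)) ^ B •
        (Matrix.of r * (1 + c • (J * M)) -
          ((-1 : PowerSeries (JetPol 𝕜 U)) ^ B * PowerSeries.X ^ B) • (M * (J * M) ^ B)) := by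
    -- The remainder carries t^(2B); one factor t^B is split off to match the truncation error.
    have e : (-c) ^ B = PowerSeries.X ^ B * ((-1) ^ B * PowerSeries.X ^ B) := by
      rw [neg_pow, hc]; ring
    have e1 : Matrix.of (seriesL Λ) + c • (Matrix.of (seriesL Λ) * J * M) =
        Matrix.of (seriesL Λ) * (1 + c • (J * M)) := by
      rw [mul_add, mul_one, Matrix.mul_smul, Matrix.mul_assoc]
    rw [e1, hL, add_mul, hgeo, e, Matrix.smul_mul, smul_sub, smul_smul]
    abel
  rw [key, Matrix.add_apply, map_add, Matrix.smul_apply, smul_eq_mul,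
    PowerSeries.coeff_X_pow_mul', if_neg (by omega), add_zero]

end Series

/-! ### Matrix algebra: Leibniz rules, resolvents, bivectors acting on covectors. -/

section Algebraic

open Matrix

variable {R : Type*} [CommRing R] {ι : Type*} [Fintype ι]

section Leibniz

variable {S : Type*} [CommRing S]

/-- The ring homomorphism `φ` is there because the variation of a jet function is a derivation along
evaluation at A, not a derivation of a single ring. -/
theorem map_mul_of_leibniz (φ : S →+* R) (δ : S →+ R)
    (hδ : ∀ a b, δ (a * b) = δ a * φ b + φ a * δ b) (M N : Matrix ι ι S) :
    (M * N).map δ = M.map δ * N.map φ + M.map φ * N.map δ := by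
  ext i j
  simp [Matrix.mul_apply, hδ, Finset.sum_add_distrib]

theorem dotProduct_of_leibniz (δ : R →+ R) (hδ : ∀ a b, δ (a * b) = δ a * b + a * δ b)
    (v w : ι → R) : δ (v ⬝ᵥ w) = (δ ∘ v) ⬝ᵥ w + v ⬝ᵥ (δ ∘ w) := by
  simp [dotProduct, hδ, Finset.sum_add_distrib]

theorem mulVec_of_leibniz (δ : R →+ R) (hδ : ∀ a b, δ (a * b) = δ a * b + a * δ b)
    (M : Matrix ι ι R) (v : ι → R) : δ ∘ (M *ᵥ v) = M.map δ *ᵥ v + M *ᵥ (δ ∘ v) := by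
  ext i
  simp [mulVec, dotProduct, hδ, Finset.sum_add_distrib]

theorem vecMul_of_leibniz (δ : R →+ R) (hδ : ∀ a b, δ (a * b) = δ a * b + a * δ b)
    (v : ι → R) (M : Matrix ι ι R) : δ ∘ (v ᵥ* M) = (δ ∘ v) ᵥ* M + v ᵥ* M.map δ := by
  ext i
  simp [vecMul, dotProduct, hδ, Finset.sum_add_distrib]

end Leibniz

section Resolvent

variable [DecidableEq ι] {J K l : Matrix ι ι R}

/-- The product in the other order is 1 directly from the resolvent identity; over a commutative
ring a one-sided inverse of a square matrix is two-sided. -/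
theorem resolvent_right_inv (hK : K + K * J * l = l) : (1 + J * l) * (1 - J * K) = 1 := by
  rw [mul_eq_one_comm]
  have : J * (K + K * J * l) = J * l := by rw [hK]
  calc (1 - J * K) * (1 + J * l) = 1 + J * l - J * (K + K * J * l) := by noncomm_ring
    _ = 1 := by rw [this]; abel

theorem resolvent_left_inv (hK : K + K * J * l = l) : (1 + l * J) * (1 - K * J) = 1 := by
  rw [mul_eq_one_comm]
  have : (K + K * J * l) * J = l * J := by rw [hK]
  calc (1 - K * J) * (1 + l * J) = 1 + l * J - (K + K * J * l) * J := by noncomm_ring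
    _ = 1 := by rw [this]; abel

theorem resolvent_eq_left (hK : K + K * J * l = l) : (1 - K * J) * l = K := by
  calc (1 - K * J) * l = l - K * J * l := by noncomm_ring
    _ = (K + K * J * l) - K * J * l := by rw [hK]
    _ = K := by abel

/-- This puts each covector ((1 - JK)f, Kf) on the graph of `l`. -/
theorem resolvent_eq_right (hK : K + K * J * l = l) : l * (1 - J * K) = K := by
  calc l * (1 - J * K) = (K + K * J * l) * (1 - J * K) := by rw [hK]
    _ = K * ((1 + J * l) * (1 - J * K)) := by noncomm_ring
    _ = K := by rw [resolvent_right_inv hK, mul_one]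

/-- The hypothesis is the differentiated resolvent identity. Solving it for `K'` means multiplying
on the right by 1 - JK, the inverse of 1 + Jl. -/
theorem resolvent_derivative (hK : K + K * J * l = l) {K' J' l' : Matrix ι ι R}
    (h : K' + (K' * J + K * J') * l + K * J * l' = l') :
    K' = (1 - K * J) * l' * (1 - J * K) - K * J' * K := by
  have h1 : K' * (1 + J * l) = (1 - K * J) * l' - K * J' * l := by
    calc K' * (1 + J * l) = (K' + (K' * J + K * J') * l + K * J * l') - K * J' * l - K * J * l' := by
          noncomm_ring
      _ = (1 - K * J) * l' - K * J' * l := by rw [h]; noncomm_ring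
  calc K' = K' * ((1 + J * l) * (1 - J * K)) := by rw [resolvent_right_inv hK, mul_one]
    _ = (K' * (1 + J * l)) * (1 - J * K) := by noncomm_ring
    _ = (1 - K * J) * l' * (1 - J * K) - K * J' * (l * (1 - J * K)) := by
          rw [h1]; noncomm_ring
    _ = _ := by rw [resolvent_eq_right hK]

end Resolvent

/-- The value of a bivector with blocks `T` (horizontal-horizontal) and `D` (horizontal-vertical)
on two covectors `(q, v)`. -/
def bform (T D : Matrix ι ι R) (u u' : (ι → R) × (ι → R)) : R :=
  u.1 ⬝ᵥ T *ᵥ u'.1 + u.1 ⬝ᵥ D *ᵥ u'.2 - u'.1 ⬝ᵥ D *ᵥ u.2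

section Bform

variable (T D : Matrix ι ι R) (u u' w : (ι → R) × (ι → R))

theorem bform_add_left : bform T D (u + w) u' = bform T D u u' + bform T D w u' := by
  simp only [bform, Prod.fst_add, Prod.snd_add, add_dotProduct, mulVec_add, dotProduct_add]
  ring

theorem bform_add_right : bform T D u (u' + w) = bform T D u u' + bform T D u w := by
  simp only [bform, Prod.fst_add, Prod.snd_add, add_dotProduct, mulVec_add, dotProduct_add]
  ring

theorem bform_smul_left (c : R) : bform T D (c • u) u' = c * bform T D u u' := by
  simp only [bform, Prod.smul_fst, Prod.smul_snd, smul_dotProduct, mulVec_smul, dotProduct_smul,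
    smul_eq_mul]
  ring

theorem bform_smul_right (c : R) : bform T D u (c • u') = c * bform T D u u' := by
  simp only [bform, Prod.smul_fst, Prod.smul_snd, smul_dotProduct, mulVec_smul, dotProduct_smul,
    smul_eq_mul]
  ring

theorem bform_sum_left {κ : Type*} (s : Finset κ) (c : κ → R) (x : κ → (ι → R) × (ι → R)) :
    bform T D (∑ k ∈ s, c k • x k) u' = ∑ k ∈ s, c k * bform T D (x k) u' := by
  classical
  induction s using Finset.induction_on with
  | empty => simp [bform]
  | insert a s ha ih => rw [Finset.sum_insert ha, Finset.sum_insert ha, bform_add_left,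
      bform_smul_left, ih]

theorem bform_sum_right {κ : Type*} (s : Finset κ) (c : κ → R) (x : κ → (ι → R) × (ι → R)) :
    bform T D u (∑ k ∈ s, c k • x k) = ∑ k ∈ s, c k * bform T D u (x k) := by
  classical
  induction s using Finset.induction_on with
  | empty => simp [bform]
  | insert a s ha ih => rw [Finset.sum_insert ha, Finset.sum_insert ha, bform_add_right,
      bform_smul_right, ih]

/-- Separates the two parts of the chain rule for the bivector along a section: its x-derivative and
J times its p-derivatives. -/
theorem bform_add_smul {κ : Type*} (s : Finset κ) (c : κ → R) (Tp Dp : κ → Matrix ι ι R) :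
    bform (T + ∑ k ∈ s, c k • Tp k) (D + ∑ k ∈ s, c k • Dp k) u u' =
      bform T D u u' + ∑ k ∈ s, c k * bform (Tp k) (Dp k) u u' := by
  classical
  induction s using Finset.induction_on with
  | empty => simp
  | insert a s ha ih =>
    rw [Finset.sum_insert ha, Finset.sum_insert ha, Finset.sum_insert ha, add_left_comm T,
      add_left_comm D, add_left_comm (bform T D u u'), ← ih]
    simp only [bform, add_mulVec, dotProduct_add, smul_mulVec, dotProduct_smul, smul_eq_mul]
    ring

variable {T}

theorem bform_swap (hT : Tᵀ = -T) : bform T D u u' = -bform T D u' u := by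
  have h : u.1 ⬝ᵥ T *ᵥ u'.1 = -(u'.1 ⬝ᵥ T *ᵥ u.1) := by
    rw [dotProduct_mulVec, dotProduct_comm, ← mulVec_transpose, hT, neg_mulVec, dotProduct_neg]
  simp only [bform, h]
  ring

variable (T)

/-- The horizontal components of the vector that a bivector assigns to a covector. -/
def sharpH : ι → R := u.1 ᵥ* T - D *ᵥ u.2

/-- The vertical components of the vector that a bivector assigns to a covector. -/
def sharpV : ι → R := u.1 ᵥ* D

theorem bform_eq_sharp : bform T D u u' = sharpH T D u ⬝ᵥ u'.1 + sharpV D u ⬝ᵥ u'.2 := by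
  simp only [bform, sharpH, sharpV, dotProduct_mulVec, sub_dotProduct]
  rw [dotProduct_comm (D *ᵥ u.2), dotProduct_mulVec u'.1]
  ring

theorem sharp_derivative (δ : R →+ R) (hδ : ∀ a b, δ (a * b) = δ a * b + a * δ b) :
    (δ ∘ sharpH T D u) ⬝ᵥ u'.1 + (δ ∘ sharpV D u) ⬝ᵥ u'.2 =
      bform (T.map δ) (D.map δ) u u' + bform T D (δ ∘ u.1, δ ∘ u.2) u' := by
  have h1 : δ ∘ sharpH T D u = δ ∘ (u.1 ᵥ* T) - δ ∘ (D *ᵥ u.2) := by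
    ext i
    simp [sharpH]
  rw [bform_eq_sharp, bform_eq_sharp, h1, sharpV, mulVec_of_leibniz δ hδ, vecMul_of_leibniz δ hδ,
    vecMul_of_leibniz δ hδ]
  simp only [sharpH, sharpV, add_dotProduct, sub_dotProduct]
  ring

theorem bform_derivative (δ : R →+ R) (hδ : ∀ a b, δ (a * b) = δ a * b + a * δ b) :
    δ (bform T D u u') = bform (T.map δ) (D.map δ) u u' + bform T D (δ ∘ u.1, δ ∘ u.2) u' +
      bform T D u (δ ∘ u'.1, δ ∘ u'.2) := by
  rw [bform_eq_sharp T D u u', map_add, dotProduct_of_leibniz δ hδ, dotProduct_of_leibniz δ hδ,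
    add_add_add_comm, sharp_derivative T D u u' δ hδ, bform_eq_sharp T D u (_, _)]

variable {T}

/-- By skew-symmetry all derivatives of the covectors cancel and only the derivative of the bivector
survives. This removes the derivatives of the dressed covectors from the recursion relations. -/
theorem sharp_derivative_antisymm (hT : Tᵀ = -T) (δ : R →+ R)
    (hδ : ∀ a b, δ (a * b) = δ a * b + a * δ b) :
    ((δ ∘ sharpV D u) ⬝ᵥ u'.2 + (δ ∘ sharpH T D u) ⬝ᵥ u'.1) -
      ((δ ∘ sharpV D u') ⬝ᵥ u.2 + (δ ∘ sharpH T D u') ⬝ᵥ u.1) - δ (bform T D u u') =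
      bform (T.map δ) (D.map δ) u u' := by
  have hT' : (T.map δ)ᵀ = -(T.map δ) := by
    rw [← transpose_map, hT]
    ext i j
    simp
  rw [add_comm, add_comm ((δ ∘ sharpV D u') ⬝ᵥ u.2), sharp_derivative T D u u' δ hδ,
    sharp_derivative T D u' u δ hδ, bform_derivative T D u u' δ hδ,
    bform_swap (D.map δ) u' u hT', bform_swap D (_, _) u hT]
  ring

end Bform

end Algebraic

/-! ### The recursion relations as linear algebra, reduced to a defect free of J. -/

section Recursion

open Matrix

variable {R : Type*} [CommRing R] {ι : Type*} [Fintype ι]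

/-- The matrix of the bivector with blocks `T`, `D` in the frame `(e_a, l e_a)`. -/
def frameForm (l T D : Matrix ι ι R) : Matrix ι ι R := T + D * l - (D * l)ᵀ

theorem bform_frame (l T D : Matrix ι ι R) (q q' : ι → R) :
    bform T D (q, l *ᵥ q) (q', l *ᵥ q') = q ⬝ᵥ frameForm l T D *ᵥ q' := by
  simp only [bform, frameForm, add_mulVec, sub_mulVec, dotProduct_add, dotProduct_sub,
    ← mulVec_mulVec]
  rw [mulVec_transpose, dotProduct_comm q ((q' ᵥ* (D * l))), ← dotProduct_mulVec, ← mulVec_mulVec]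

/-- The derivative of the `k`-th row of `l` along the frame vectors. -/
def frameDeriv (lx lp : ι → Matrix ι ι R) (l T D : Matrix ι ι R) (k : ι) : Matrix ι ι R :=
  (T - (D * l)ᵀ) * (Matrix.of fun m b => lx m k b) + D * (Matrix.of fun m b => lp m k b)

theorem frameDeriv_apply (lx lp : ι → Matrix ι ι R) (l T D : Matrix ι ι R) (k : ι) (q q' : ι → R) :
    ((∑ m, sharpH T D (q, l *ᵥ q) m • lx m + ∑ n, sharpV D (q, l *ᵥ q) n • lp n) *ᵥ q') k =
      q ⬝ᵥ frameDeriv lx lp l T D k *ᵥ q' := by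
  have h1 : sharpH T D (q, l *ᵥ q) = q ᵥ* (T - (D * l)ᵀ) := by
    rw [vecMul_sub, vecMul_transpose, sharpH, mulVec_mulVec]
  have h2 : ∀ (c : ι → R) (N : ι → Matrix ι ι R),
      ((∑ m, c m • N m) *ᵥ q') k = c ⬝ᵥ (Matrix.of fun m b => N m k b) *ᵥ q' := by
    intro c N
    simp only [sum_mulVec, smul_mulVec, Finset.sum_apply, Pi.smul_apply, smul_eq_mul]
    simp only [mulVec, dotProduct, Matrix.of_apply]
  rw [add_mulVec, Pi.add_apply, h2, h2, h1, sharpV, frameDeriv, add_mulVec, dotProduct_add,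
    ← mulVec_mulVec, ← mulVec_mulVec, ← dotProduct_mulVec, ← dotProduct_mulVec]

/-- The defect of the recursion relations in terms of `l`, as a vector. -/
def defect (lx lp Tx Tp Dx Dp : ι → Matrix ι ι R) (l T D : Matrix ι ι R) (u u' : (ι → R) × (ι → R)) :
    ι → R :=
  (∑ m, sharpH T D u m • lx m + ∑ n, sharpV D u n • lp n) *ᵥ u'.1 -
    (∑ m, sharpH T D u' m • lx m + ∑ n, sharpV D u' n • lp n) *ᵥ u.1 +
    (fun k => bform (Tp k) (Dp k) u u') - l *ᵥ (fun k => bform (Tx k) (Dx k) u u')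

/-- The `k`-th component of the defect as a bilinear form. -/
def defectMatrix (lx lp Tx Tp Dx Dp : ι → Matrix ι ι R) (l T D : Matrix ι ι R) (k : ι) :
    Matrix ι ι R :=
  frameDeriv lx lp l T D k - (frameDeriv lx lp l T D k)ᵀ + frameForm l (Tp k) (Dp k) -
    ∑ m, l k m • frameForm l (Tx m) (Dx m)

/-- On the graph of `l` the vertical parts are determined by the horizontal ones, so each component
becomes an ordinary bilinear form in q and q'. -/
theorem defect_frame (lx lp Tx Tp Dx Dp : ι → Matrix ι ι R) (l T D : Matrix ι ι R) (k : ι)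
    (q q' : ι → R) : defect lx lp Tx Tp Dx Dp l T D (q, l *ᵥ q) (q', l *ᵥ q') k =
      q ⬝ᵥ defectMatrix lx lp Tx Tp Dx Dp l T D k *ᵥ q' := by
  have h1 : (l *ᵥ fun k => bform (Tx k) (Dx k) (q, l *ᵥ q) (q', l *ᵥ q')) k =
      q ⬝ᵥ (∑ m, l k m • frameForm l (Tx m) (Dx m)) *ᵥ q' := by
    simp only [sum_mulVec, smul_mulVec, dotProduct_sum, dotProduct_smul, smul_eq_mul,
      ← bform_frame]
    rfl
  rw [defectMatrix, sub_mulVec, dotProduct_sub, ← h1, add_mulVec, dotProduct_add, ← bform_frame,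
    sub_mulVec, dotProduct_sub, mulVec_transpose, dotProduct_comm q (q' ᵥ* _), ← dotProduct_mulVec,
    ← frameDeriv_apply, ← frameDeriv_apply]
  rfl

variable [DecidableEq ι]

/-- The gauge variation and the transport of `K df` combine into the derivative of `l` along the
vector with components `ξ`, `π`. -/
theorem variation_add_transport (δ : ι → R →+ R)
    (hδ : ∀ k a b, δ k (a * b) = δ k a * b + a * δ k b)
    {J K l : Matrix ι ι R} (lx lp : ι → Matrix ι ι R)
    (hJ : ∀ k m n, δ k (J m n) = δ m (J k n))
    (hK : ∀ k, K.map (δ k) = (1 - K * J) * l.map (δ k) * (1 - J * K) - K * J.map (δ k) * K)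
    (hl : ∀ k, l.map (δ k) = lx k + ∑ m, J k m • lp m)
    (ξ π a : ι → R) (ha : ∀ n, a n = π n - ∑ m, ξ m * J m n) {δK : Matrix ι ι R}
    (hδK : δK = (1 - K * J) * (∑ n, a n • lp n) * (1 - J * K) -
      K * (Matrix.of fun k n => δ k (a n)) * K)
    (g : ι → R) (hg : ∀ k m, δ k (g m) = δ m (g k)) :
    δK *ᵥ g + ∑ m, ξ m • (δ m ∘ (K *ᵥ g)) =
      (1 - K * J) *ᵥ ((∑ m, ξ m • lx m + ∑ n, π n • lp n) *ᵥ ((1 - J * K) *ᵥ g)) -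
      K *ᵥ (fun k => (δ k ∘ π) ⬝ᵥ (K *ᵥ g) + (δ k ∘ ξ) ⬝ᵥ ((1 - J * K) *ᵥ g) - δ k (ξ ⬝ᵥ g)) := by
  set v := K *ᵥ g with hv
  set q := (1 - J * K) *ᵥ g with hq
  have hqv : q = g - J *ᵥ v := by
    rw [hq, sub_mulVec, one_mulVec, ← mulVec_mulVec]
  have h1 : δK *ᵥ g = (1 - K * J) *ᵥ ((∑ n, a n • lp n) *ᵥ q) -
      K *ᵥ ((Matrix.of fun k n => δ k (a n)) *ᵥ v) := by
    rw [hδK, sub_mulVec, ← mulVec_mulVec, ← mulVec_mulVec, ← mulVec_mulVec, ← mulVec_mulVec]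
  have h2 : ∀ m, δ m ∘ v = (1 - K * J) *ᵥ (l.map (δ m) *ᵥ q) - K *ᵥ (J.map (δ m) *ᵥ v) +
      K *ᵥ (δ m ∘ g) := by
    intro m
    rw [hv, mulVec_of_leibniz (δ m) (hδ m), hK, sub_mulVec, ← mulVec_mulVec, ← mulVec_mulVec,
      ← mulVec_mulVec, ← mulVec_mulVec]
  -- The part -ξJ of the gauge variation `a` cancels the J-part of the chain rule for `l` along ξ.
  have h3 : ∑ n, a n • lp n + ∑ m, ξ m • l.map (δ m) =
      ∑ m, ξ m • lx m + ∑ n, π n • lp n := by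
    simp only [hl, ha, sub_smul, Finset.sum_sub_distrib, smul_add, Finset.sum_add_distrib,
      Finset.smul_sum, Finset.sum_smul, smul_smul]
    rw [Finset.sum_comm (f := fun i m => (ξ m * J m i) • lp i)]
    abel
  -- By `hJ` the derivatives of J in δ_k(a) cancel those from transport along ξ. By `hg` the
  -- transport of `g` becomes the derivative of ξ·g up to (δ_k ξ)·g, which combines with J v into
  -- `q`.
  have h4 : (Matrix.of fun k n => δ k (a n)) *ᵥ v + ∑ m, ξ m • (J.map (δ m) *ᵥ v) -
      ∑ m, ξ m • (δ m ∘ g) =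
      fun k => (δ k ∘ π) ⬝ᵥ v + (δ k ∘ ξ) ⬝ᵥ q - δ k (ξ ⬝ᵥ g) := by
    ext k
    have e1 : ∀ n, δ k (a n) = δ k (π n) - ∑ m, δ k (ξ m) * J m n - ∑ m, ξ m * δ m (J k n) := by
      intro n
      simp only [ha, map_sub, map_sum, hδ, Finset.sum_add_distrib, hJ k]
      ring
    rw [dotProduct_of_leibniz (δ k) (hδ k), hqv]
    simp only [Pi.add_apply, Pi.sub_apply, Finset.sum_apply, Pi.smul_apply, smul_eq_mul, mulVec,
      dotProduct, Matrix.of_apply, Matrix.map_apply, Function.comp_apply, e1, hg k, mul_sub,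
      sub_mul, Finset.sum_sub_distrib, Finset.mul_sum, Finset.sum_mul]
    rw [Finset.sum_comm (f := fun n m => δ k (ξ m) * J m n * v n),
      Finset.sum_comm (f := fun n m => ξ m * δ m (J k n) * v n)]
    simp only [mul_assoc]
    ring
  rw [h1]
  simp only [h2, smul_add, smul_sub, Finset.sum_add_distrib, Finset.sum_sub_distrib]
  rw [← h3, ← h4]
  simp only [add_mulVec, sum_mulVec, smul_mulVec, mulVec_add, mulVec_sub, mulVec_sum, mulVec_smul]
  abel

/-- The variation and transport terms give derivatives of `l` along the dressed vectors, already
carrying the factor 1 - KJ, plus K applied to derivatives of those vectors. Together with the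
derivative of the gauge parameter `h`, the latter collapse to derivatives of the bivector by
skew-symmetry. -/
theorem recursion_sub_eq_defect (δ : ι → R →+ R)
    (hδ : ∀ k a b, δ k (a * b) = δ k a * b + a * δ k b)
    {J K l T D : Matrix ι ι R} (lx lp Tx Tp Dx Dp : ι → Matrix ι ι R)
    (hJ : ∀ k m n, δ k (J m n) = δ m (J k n)) (hT : Tᵀ = -T)
    (hKl : K + K * J * l = l)
    (hK : ∀ k, K.map (δ k) = (1 - K * J) * l.map (δ k) * (1 - J * K) - K * J.map (δ k) * K)
    (hl : ∀ k, l.map (δ k) = lx k + ∑ m, J k m • lp m)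
    (hTd : ∀ k, T.map (δ k) = Tx k + ∑ m, J k m • Tp m)
    (hDd : ∀ k, D.map (δ k) = Dx k + ∑ m, J k m • Dp m)
    (f g : ι → R) (hf : ∀ k m, δ k (f m) = δ m (f k)) (hg : ∀ k m, δ k (g m) = δ m (g k))
    {u u' : (ι → R) × (ι → R)} (hu : u = ((1 - J * K) *ᵥ f, K *ᵥ f))
    (hu' : u' = ((1 - J * K) *ᵥ g, K *ᵥ g))
    (a b : ι → R) (ha : ∀ n, a n = sharpV D u n - ∑ m, sharpH T D u m * J m n)
    (hb : ∀ n, b n = sharpV D u' n - ∑ m, sharpH T D u' m * J m n)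
    {δK δK' : Matrix ι ι R}
    (hδK : δK = (1 - K * J) * (∑ n, a n • lp n) * (1 - J * K) -
      K * (Matrix.of fun k n => δ k (a n)) * K)
    (hδK' : δK' = (1 - K * J) * (∑ n, b n • lp n) * (1 - J * K) -
      K * (Matrix.of fun k n => δ k (b n)) * K)
    {h : R} (hh : h = bform T D (f, 0) (g, 0) -
      bform T D (-(J *ᵥ (K *ᵥ f)), K *ᵥ f) (-(J *ᵥ (K *ᵥ g)), K *ᵥ g)) :
    (δK *ᵥ g + ∑ m, sharpH T D u m • (δ m ∘ (K *ᵥ g))) -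
      (δK' *ᵥ f + ∑ m, sharpH T D u' m • (δ m ∘ (K *ᵥ f))) +
      (fun i => bform (Tp i) (Dp i) u u') - K *ᵥ (fun k => δ k h) =
    (1 - K * J) *ᵥ defect lx lp Tx Tp Dx Dp l T D u u' := by
  have hqv : ∀ g : ι → R, (1 - J * K) *ᵥ g = g + -(J *ᵥ (K *ᵥ g)) := by
    intro g
    rw [sub_mulVec, one_mulVec, ← mulVec_mulVec, sub_eq_add_neg]
  have hus : u = (f, 0) + (-(J *ᵥ (K *ᵥ f)), K *ᵥ f) := by
    rw [hu, hqv, Prod.mk_add_mk, zero_add]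
  have hus' : u' = (g, 0) + (-(J *ᵥ (K *ᵥ g)), K *ᵥ g) := by
    rw [hu', hqv, Prod.mk_add_mk, zero_add]
  have e1 : sharpH T D u ⬝ᵥ g = bform T D u (g, 0) := by simp [bform_eq_sharp]
  have e2 : sharpH T D u' ⬝ᵥ f = bform T D u' (f, 0) := by simp [bform_eq_sharp]
  -- Each dressed covector is a sum (df, 0) + (-Jv, v). In the bilinear expansion `h` supplies the
  -- pure terms with the signs that complete the value on the dressed covectors.
  have hB : h - sharpH T D u ⬝ᵥ g + sharpH T D u' ⬝ᵥ f = -bform T D u u' := by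
    rw [e1, e2, bform_swap D u' (f, 0) hT, hh, hus, hus']
    simp only [bform_add_left, bform_add_right]
    ring
  have hsum : ∀ k, ((δ k ∘ sharpV D u) ⬝ᵥ u'.2 + (δ k ∘ sharpH T D u) ⬝ᵥ u'.1
        - δ k (sharpH T D u ⬝ᵥ g)) -
      ((δ k ∘ sharpV D u') ⬝ᵥ u.2 + (δ k ∘ sharpH T D u') ⬝ᵥ u.1
        - δ k (sharpH T D u' ⬝ᵥ f)) + δ k h =
      bform (Tx k) (Dx k) u u' + ∑ m, J k m * bform (Tp m) (Dp m) u u' := by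
    intro k
    rw [← bform_add_smul, ← hTd, ← hDd, ← sharp_derivative_antisymm D u u' hT (δ k) (hδ k)]
    have := congrArg (δ k) hB
    simp only [map_add, map_sub, map_neg] at this
    linear_combination this
  have hA := variation_add_transport δ hδ lx lp hJ hK hl _ _ a ha hδK g hg
  have hA' := variation_add_transport δ hδ lx lp hJ hK hl _ _ b hb hδK' f hf
  have hu1 : (1 - J * K) *ᵥ f = u.1 := by rw [hu]
  have hu2 : K *ᵥ f = u.2 := by rw [hu]
  have hu1' : (1 - J * K) *ᵥ g = u'.1 := by rw [hu']
  have hu2' : K *ᵥ g = u'.2 := by rw [hu']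
  rw [hu1', hu2'] at hA
  rw [hu1, hu2] at hA'
  rw [hu2, hu2', hA, hA']
  have hK2 : K *ᵥ (fun k => (δ k ∘ sharpV D u) ⬝ᵥ u'.2 + (δ k ∘ sharpH T D u) ⬝ᵥ u'.1
        - δ k (sharpH T D u ⬝ᵥ g)) -
      K *ᵥ (fun k => (δ k ∘ sharpV D u') ⬝ᵥ u.2 + (δ k ∘ sharpH T D u') ⬝ᵥ u.1
        - δ k (sharpH T D u' ⬝ᵥ f)) + K *ᵥ (fun k => δ k h) =
      K *ᵥ (fun k => bform (Tx k) (Dx k) u u') +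
        (K * J) *ᵥ (fun k => bform (Tp k) (Dp k) u u') := by
    rw [← mulVec_mulVec, ← mulVec_sub, ← mulVec_add, ← mulVec_add]
    congr 1
    ext k
    exact hsum k
  -- The remaining terms acquire the common factor: K = (1 - KJ)l absorbs the x-derivatives, and the
  -- KJ-multiple of the p-derivatives completes the bare p-derivative term to (1 - KJ) times it.
  have hKP : K *ᵥ (fun k => bform (Tx k) (Dx k) u u') =
      (1 - K * J) *ᵥ (l *ᵥ (fun k => bform (Tx k) (Dx k) u u')) := by
    rw [mulVec_mulVec, resolvent_eq_left hKl]
  have hP : (1 - K * J) *ᵥ (fun k => bform (Tp k) (Dp k) u u') =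
      (fun k => bform (Tp k) (Dp k) u u') - (K * J) *ᵥ (fun k => bform (Tp k) (Dp k) u u') := by
    rw [sub_mulVec, one_mulVec]
  rw [defect, mulVec_sub, mulVec_add, mulVec_sub, ← hKP, hP, ← sub_eq_zero]
  rw [← sub_eq_zero] at hK2
  rw [← neg_eq_zero, ← hK2]
  abel

/-- Multiplying by 1 + lJ strips the left factor. The basis vectors then read off the entries of
QᵀZQ with Q = 1 - JK, and conjugation by the inverse 1 + Jl gives Z = 0. -/
theorem defectMatrix_eq_zero {J K l T D : Matrix ι ι R}
    (lx lp Tx Tp Dx Dp : ι → Matrix ι ι R) (hKl : K + K * J * l = l)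
    (h : ∀ c e : ι, (1 - K * J) *ᵥ defect lx lp Tx Tp Dx Dp l T D
      ((1 - J * K) *ᵥ Pi.single c 1, K *ᵥ Pi.single c 1)
      ((1 - J * K) *ᵥ Pi.single e 1, K *ᵥ Pi.single e 1) = 0) (k : ι) :
    defectMatrix lx lp Tx Tp Dx Dp l T D k = 0 := by
  set Z := defectMatrix lx lp Tx Tp Dx Dp l T D k with hZ
  set Q := 1 - J * K with hQ
  have hKQ : ∀ f : ι → R, K *ᵥ f = l *ᵥ (Q *ᵥ f) := by
    intro f
    rw [mulVec_mulVec, hQ, resolvent_eq_right hKl]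
  have h1 : Qᵀ * Z * Q = 0 := by
    ext c e
    have h2 := congrArg (fun v => ((1 + l * J) *ᵥ v) k) (h c e)
    simp only [mulVec_mulVec _ (1 + l * J), resolvent_left_inv hKl, one_mulVec, mulVec_zero, hKQ,
      defect_frame, Pi.zero_apply] at h2
    rw [← hZ, mulVec_single_one, mulVec_single_one] at h2
    rw [Matrix.zero_apply, ← h2, Matrix.mul_assoc]
    rfl
  have h3 : Q * (1 + J * l) = 1 := mul_eq_one_comm.mp (resolvent_right_inv hKl)
  calc Z = (Q * (1 + J * l))ᵀ * Z * (Q * (1 + J * l)) := by rw [h3]; simp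
    _ = (1 + J * l)ᵀ * (Qᵀ * Z * Q) * (1 + J * l) := by
          rw [transpose_mul]; simp only [Matrix.mul_assoc]
    _ = 0 := by rw [h1]; simp

theorem defect_eq_zero {J K l T D : Matrix ι ι R}
    (lx lp Tx Tp Dx Dp : ι → Matrix ι ι R) (hKl : K + K * J * l = l)
    (h : ∀ k, defectMatrix lx lp Tx Tp Dx Dp l T D k = 0) (f g : ι → R) :
    defect lx lp Tx Tp Dx Dp l T D
      ((1 - J * K) *ᵥ f, K *ᵥ f) ((1 - J * K) *ᵥ g, K *ᵥ g) = 0 := by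
  have hKQ : ∀ f : ι → R, K *ᵥ f = l *ᵥ ((1 - J * K) *ᵥ f) := by
    intro f
    rw [mulVec_mulVec, resolvent_eq_right hKl]
  ext k
  rw [hKQ, hKQ, defect_frame, h]
  simp

/-- Here the differential system appears, with one overall factor `x` = t. The identity part of the
mixed block gives the left side of the system; its right side comes from Θ, γ and their derivatives.
-/
theorem defectMatrix_apply (x : R) (L Th ga : ι → ι → R) (Lx Lp Tx Tp Dx Dp : ι → ι → ι → R)
    (i j k : ι) :
    defectMatrix (fun m => Matrix.of fun a b => x ^ 2 * Lx m a b)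
      (fun m => Matrix.of fun a b => x ^ 2 * Lp m a b)
      (fun m => Matrix.of fun a b => x * Tx m a b) (fun m => Matrix.of fun a b => x * Tp m a b)
      (fun m => Matrix.of fun a b => x * Dx m a b) (fun m => Matrix.of fun a b => x * Dp m a b)
      (Matrix.of fun a b => x ^ 2 * L a b) (Matrix.of fun a b => x * Th a b)
      (Matrix.of fun a b => (if a = b then 1 else 0) + x * ga a b) k i j =
    x * ((x * (Lp i k j - Lp j k i) + x ^ 3 * ∑ l, (L l j * Lx l k i - L l i * Lx l k j)) -
      (-Tp k i j + x ^ 2 * (∑ l, (L k l * Tx l i j + L l i * Dp k j l - L l j * Dp k i l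
          + Th j l * Lx l k i - Th i l * Lx l k j + ga j l * Lp l k i - ga i l * Lp l k j))
        + x ^ 4 * ∑ l, ∑ m, (ga l m * L m i * Lx l k j - ga l m * L m j * Lx l k i
          + L k l * L m j * Dx l i m - L k l * L m i * Dx l j m))) := by
  have hF : ∀ a b, frameDeriv (fun m => Matrix.of fun a b => x ^ 2 * Lx m a b)
      (fun m => Matrix.of fun a b => x ^ 2 * Lp m a b)
      (Matrix.of fun a b => x ^ 2 * L a b) (Matrix.of fun a b => x * Th a b)
      (Matrix.of fun a b => (if a = b then 1 else 0) + x * ga a b) k a b =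
      x ^ 3 * (∑ l, Th a l * Lx l k b) - x ^ 4 * (∑ l, L l a * Lx l k b)
        - x ^ 5 * (∑ l, ∑ m, ga l m * L m a * Lx l k b) + x ^ 2 * Lp a k b
        + x ^ 3 * ∑ l, ga a l * Lp l k b := by
    intro a b
    simp only [frameDeriv, Matrix.add_apply, Matrix.sub_apply, Matrix.mul_apply,
      Matrix.transpose_apply, Matrix.of_apply, add_mul, ite_mul, one_mul, zero_mul,
      Finset.sum_add_distrib, Finset.sum_ite_eq, Finset.mem_univ, if_true, sub_mul,
      Finset.mul_sum, Finset.sum_mul]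
    have e1 : ∀ l, x * Th a l * (x ^ 2 * Lx l k b) = x ^ 3 * (Th a l * Lx l k b) := by
      intro l; ring
    have e2 : ∀ l, x ^ 2 * L l a * (x ^ 2 * Lx l k b) = x ^ 4 * (L l a * Lx l k b) := by
      intro l; ring
    have e3 : ∀ l m, x * ga l m * (x ^ 2 * L m a) * (x ^ 2 * Lx l k b) =
        x ^ 5 * (ga l m * L m a * Lx l k b) := by
      intro l m; ring
    have e4 : ∀ l, x * ga a l * (x ^ 2 * Lp l k b) = x ^ 3 * (ga a l * Lp l k b) := by
      intro l; ring
    simp only [e1, e2, e3, e4]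
    ring
  have hG : ∀ (T D : ι → ι → R) a b, frameForm (Matrix.of fun a b => x ^ 2 * L a b)
      (Matrix.of fun a b => x * T a b) (Matrix.of fun a b => x * D a b) a b =
      x * T a b + x ^ 3 * (∑ l, L l b * D a l) - x ^ 3 * ∑ l, L l a * D b l := by
    intro T D a b
    simp only [frameForm, Matrix.add_apply, Matrix.sub_apply, Matrix.mul_apply,
      Matrix.transpose_apply, Matrix.of_apply, Finset.mul_sum]
    congr 1
    · congr 1
      exact Finset.sum_congr rfl fun l _ => by ring
    · exact Finset.sum_congr rfl fun l _ => by ring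
  have hS : ∑ m, x ^ 2 * L k m * (x * Tx m i j + x ^ 3 * (∑ l, L l j * Dx m i l)
      - x ^ 3 * ∑ l, L l i * Dx m j l) = x ^ 3 * (∑ l, L k l * Tx l i j) +
      x ^ 5 * (∑ l, ∑ m, L k l * L m j * Dx l i m) -
      x ^ 5 * ∑ l, ∑ m, L k l * L m i * Dx l j m := by
    simp only [Finset.mul_sum, mul_add, mul_sub, Finset.sum_add_distrib, Finset.sum_sub_distrib]
    congr 1
    · congr 1
      · exact Finset.sum_congr rfl fun l _ => by ring
      · exact Finset.sum_congr rfl fun l _ => Finset.sum_congr rfl fun m _ => by ring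
    · exact Finset.sum_congr rfl fun l _ => Finset.sum_congr rfl fun m _ => by ring
  rw [defectMatrix, Matrix.sub_apply, Matrix.add_apply, Matrix.sub_apply, Matrix.transpose_apply,
    hF, hF, hG, Matrix.sum_apply]
  simp only [Matrix.smul_apply, hG, smul_eq_mul]
  rw [show (∑ m, (Matrix.of fun a b => x ^ 2 * L a b) k m * (x * Tx m i j +
      x ^ 3 * (∑ l, L l j * Dx m i l) - x ^ 3 * ∑ l, L l i * Dx m j l)) = _ from hS]
  simp only [Finset.sum_add_distrib, Finset.sum_sub_distrib]
  ring

end Recursion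

/-! ### Gradients along a section, and brackets as values of the bivector on them. -/

section Gradients

open Matrix

variable {𝕜 : Type*} [RCLike 𝕜] {d : ℕ} {U : TopologicalSpace.Opens (Fin d → ℝ)}

/-- `∂_k` on `C^∞(U)[[t]]` as an additive map. -/
def dBaseHom (k : Fin d) : PowerSeries (CInf 𝕜 U) →+ PowerSeries (CInf 𝕜 U) :=
  AddMonoidHom.mk' (dBase k) (map_add (coeffDer (derX k)))

theorem dBaseHom_mul (k : Fin d) (F G : PowerSeries (CInf 𝕜 U)) :
    dBaseHom k (F * G) = dBaseHom k F * G + F * dBaseHom k G := by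
  have := Derivation.leibniz (coeffDer (derX (𝕜 := 𝕜) (U := U) k)) F G
  simp only [smul_eq_mul] at this
  change coeffDer (derX k) (F * G) = coeffDer (derX k) F * G + F * coeffDer (derX k) G
  rw [this]
  ring

theorem dBaseHom_X_pow_mul (k : Fin d) (n : ℕ) (F : PowerSeries (CInf 𝕜 U)) :
    dBaseHom k (PowerSeries.X ^ n * F) = PowerSeries.X ^ n * dBaseHom k F :=
  coeffDer_X_pow_mul (derX k) n F

theorem dBaseHom_X_mul (k : Fin d) (F : PowerSeries (CInf 𝕜 U)) :
    dBaseHom k (PowerSeries.X * F) = PowerSeries.X * dBaseHom k F := by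
  simpa using dBaseHom_X_pow_mul k 1 F

theorem dBaseHom_const (k : Fin d) (f : CInf 𝕜 U) : dBaseHom k (const f) = const (partialX k f) :=
  coeffDer_C (derX k) f

theorem dBaseHom_comm (k m : Fin d) (f : CInf 𝕜 U) :
    dBaseHom k (dBaseHom m (const f)) = dBaseHom m (dBaseHom k (const f)) := by
  simp only [dBaseHom_const, partialX_comm k m]

/-- The pullback `s_A^*` as a ring homomorphism. -/
def secHom (A : Fin d → CInf 𝕜 U) : PowerSeries (CotPol 𝕜 U) →+* PowerSeries (CInf 𝕜 U) :=
  PowerSeries.map (MvPolynomial.eval A)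

theorem secHom_apply (A : Fin d → CInf 𝕜 U) (F : PowerSeries (CotPol 𝕜 U)) :
    secHom A F = pullSection A F := rfl

theorem secHom_X (A : Fin d → CInf 𝕜 U) : secHom A PowerSeries.X = PowerSeries.X :=
  PowerSeries.map_X _

theorem secHom_pullBase (A : Fin d → CInf 𝕜 U) (h : PowerSeries (CInf 𝕜 U)) :
    secHom A (pullBase h) = h := by
  ext1 n
  simp [secHom, pullBase]

theorem secHom_Phi (A : Fin d → CInf 𝕜 U) (i : Fin d) : secHom A (Phi A i) = 0 := by
  rw [Phi, map_sub, secHom_pullBase]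
  simp [secHom, const]

theorem dX_add (i : Fin d) (F G : PowerSeries (CotPol 𝕜 U)) : dX i (F + G) = dX i F + dX i G :=
  map_add (coeffDer (polyDer (derX i))) F G

theorem dX_sub (i : Fin d) (F G : PowerSeries (CotPol 𝕜 U)) : dX i (F - G) = dX i F - dX i G :=
  map_sub (coeffDer (polyDer (derX i))) F G

theorem dX_sum {κ : Type*} (s : Finset κ) (i : Fin d) (F : κ → PowerSeries (CotPol 𝕜 U)) :
    dX i (∑ k ∈ s, F k) = ∑ k ∈ s, dX i (F k) :=
  map_sum (coeffDer (polyDer (derX i))) F s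

theorem dX_mul (i : Fin d) (F G : PowerSeries (CotPol 𝕜 U)) :
    dX i (F * G) = F * dX i G + G * dX i F :=
  Derivation.leibniz (coeffDer (polyDer (derX i))) F G

theorem dX_pullBase (i : Fin d) (h : PowerSeries (CInf 𝕜 U)) :
    dX i (pullBase h) = pullBase (dBase i h) := by
  ext1 n
  simp only [dX, pullBase, dBase, PowerSeries.coeff_map, coeffwise, PowerSeries.coeff_mk]
  exact polyDer_C (derX i) _

theorem dX_C_X (i j : Fin d) :
    dX i (PowerSeries.C (MvPolynomial.X j) : PowerSeries (CotPol 𝕜 U)) = 0 := by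
  have := coeffDer_C (polyDer (derX (𝕜 := 𝕜) (U := U) i)) (MvPolynomial.X j)
  exact (this.trans (congrArg PowerSeries.C (polyDer_X (derX i) j))).trans (map_zero _)

/-- `∂/∂p_i` as a derivation. -/
def derP (i : Fin d) :
    Derivation ℤ (PowerSeries (CotPol 𝕜 U)) (PowerSeries (CotPol 𝕜 U)) :=
  coeffDer ((MvPolynomial.pderiv i).restrictScalars ℤ)

theorem dP_add (i : Fin d) (F G : PowerSeries (CotPol 𝕜 U)) : dP i (F + G) = dP i F + dP i G :=
  map_add (derP i) F G

theorem dP_sub (i : Fin d) (F G : PowerSeries (CotPol 𝕜 U)) : dP i (F - G) = dP i F - dP i G :=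
  map_sub (derP i) F G

theorem dP_sum {κ : Type*} (s : Finset κ) (i : Fin d) (F : κ → PowerSeries (CotPol 𝕜 U)) :
    dP i (∑ k ∈ s, F k) = ∑ k ∈ s, dP i (F k) :=
  map_sum (derP i) F s

theorem dP_mul (i : Fin d) (F G : PowerSeries (CotPol 𝕜 U)) :
    dP i (F * G) = F * dP i G + G * dP i F :=
  Derivation.leibniz (derP i) F G

theorem dP_one (i : Fin d) : dP i (1 : PowerSeries (CotPol 𝕜 U)) = 0 :=
  Derivation.map_one_eq_zero (derP i)

theorem dP_zero (i : Fin d) : dP i (0 : PowerSeries (CotPol 𝕜 U)) = 0 :=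
  map_zero (derP i)

theorem dP_neg (i : Fin d) (F : PowerSeries (CotPol 𝕜 U)) : dP i (-F) = -dP i F :=
  map_neg (derP i) F

theorem dP_X (i : Fin d) : dP i (PowerSeries.X : PowerSeries (CotPol 𝕜 U)) = 0 :=
  coeffDer_X (R := CotPol 𝕜 U)
    ((MvPolynomial.pderiv (R := CInf 𝕜 U) i : Derivation _ _ (CotPol 𝕜 U)).restrictScalars ℤ)

theorem dP_pullBase (i : Fin d) (h : PowerSeries (CInf 𝕜 U)) : dP i (pullBase h) = 0 := by
  ext1 n
  simp [dP, coeffwise, pullBase]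

theorem dP_C_X (i j : Fin d) :
    dP i (PowerSeries.C (MvPolynomial.X j) : PowerSeries (CotPol 𝕜 U)) =
      if i = j then 1 else 0 := by
  have := coeffDer_C ((MvPolynomial.pderiv i).restrictScalars ℤ)
    (MvPolynomial.X j : CotPol 𝕜 U)
  refine this.trans ?_
  rw [Derivation.restrictScalars_apply, MvPolynomial.pderiv_X, Pi.single_apply]
  by_cases h : i = j
  · simp [h]
  · simp [h, Ne.symm h]

theorem dBase_pullSection (A : Fin d → CInf 𝕜 U) (k : Fin d) (F : PowerSeries (CotPol 𝕜 U)) :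
    dBaseHom k (secHom A F) = secHom A (dX k F) +
      ∑ m, const (partialX k (A m)) * secHom A (dP m F) :=
  der_eval_coeffwise (derX k) A F

/-- The gradient of a function on `T^*U` along the section `s_A`. -/
def grad (A : Fin d → CInf 𝕜 U) (F : PowerSeries (CotPol 𝕜 U)) :
    (Fin d → PowerSeries (CInf 𝕜 U)) × (Fin d → PowerSeries (CInf 𝕜 U)) :=
  (fun i => secHom A (dX i F), fun i => secHom A (dP i F))

/-- The matrix `∂_k A_m`. -/
def jac (A : Fin d → CInf 𝕜 U) : Matrix (Fin d) (Fin d) (PowerSeries (CInf 𝕜 U)) :=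
  Matrix.of fun k m => const (partialX k (A m))

theorem grad_add (A : Fin d → CInf 𝕜 U) (F G : PowerSeries (CotPol 𝕜 U)) :
    grad A (F + G) = grad A F + grad A G := by
  simp only [grad, dX_add, dP_add, map_add]
  rfl

theorem grad_pullBase (A : Fin d → CInf 𝕜 U) (h : PowerSeries (CInf 𝕜 U)) :
    grad A (pullBase h) = (fun i => dBaseHom i h, 0) := by
  simp only [grad, dX_pullBase, dP_pullBase, map_zero, secHom_pullBase]
  rfl

theorem dX_Phi (A : Fin d → CInf 𝕜 U) (i l : Fin d) :
    dX i (Phi A l) = -pullBase (const (partialX i (A l))) := by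
  rw [Phi, dX_sub, dX_C_X, dX_pullBase, zero_sub]
  exact congrArg (fun h => -pullBase h) (dBaseHom_const i (A l))

theorem dP_Phi (A : Fin d → CInf 𝕜 U) (i l : Fin d) :
    dP i (Phi A l) = if i = l then 1 else 0 := by
  rw [Phi, dP_sub, dP_C_X, dP_pullBase, sub_zero]

theorem grad_Phi (A : Fin d → CInf 𝕜 U) (l : Fin d) :
    grad A (Phi A l) = (-(jac A *ᵥ Pi.single l 1), Pi.single l 1) := by
  refine Prod.ext ?_ ?_
  · ext1 i
    simp only [grad, dX_Phi, map_neg, secHom_pullBase, mulVec_single_one]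
    rfl
  · ext1 i
    simp only [grad, dP_Phi, Pi.single_apply]
    split <;> simp

theorem sum_smul_grad_Phi (A : Fin d → CInf 𝕜 U) (V : Fin d → PowerSeries (CInf 𝕜 U)) :
    ∑ l, V l • grad A (Phi A l) = (-(jac A *ᵥ V), V) := by
  have h : ∑ l, V l • Pi.single l (1 : PowerSeries (CInf 𝕜 U)) = V := by
    ext1 i
    simp [Pi.single_apply]
  simp only [grad_Phi]
  refine Prod.ext ?_ ?_
  · simp only [Prod.fst_sum, Prod.smul_fst, smul_neg, Finset.sum_neg_distrib, ← mulVec_smul,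
      ← mulVec_sum, h]
  · simp only [Prod.snd_sum, Prod.smul_snd, h]

/-- The constraints vanish on the section, so derivatives of the coefficients V do not contribute.
-/
theorem grad_PhiV (A : Fin d → CInf 𝕜 U) (V : Fin d → PowerSeries (CInf 𝕜 U)) :
    grad A (PhiV A V) = (-(jac A *ᵥ V), V) := by
  rw [← sum_smul_grad_Phi]
  refine Prod.ext ?_ ?_
  · ext1 i
    simp only [grad, PhiV, dX_sum, dX_mul, map_sum, map_add, map_mul, secHom_pullBase, secHom_Phi,
      zero_mul, add_zero, Prod.fst_sum, Prod.smul_fst, Finset.sum_apply, Pi.smul_apply, smul_eq_mul]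
  · ext1 i
    simp only [grad, PhiV, dP_sum, dP_mul, map_sum, map_add, map_mul, secHom_pullBase, secHom_Phi,
      zero_mul, add_zero, Prod.snd_sum, Prod.smul_snd, Finset.sum_apply, Pi.smul_apply, smul_eq_mul]

variable {θ : AlmostPoissonStructure 𝕜 U} (Ω : LocalSymplecticEmbedding θ)

/-- The horizontal block `t Θ^{ij}` of the bivector along `s_A`. -/
def blockT (A : Fin d → CInf 𝕜 U) : Matrix (Fin d) (Fin d) (PowerSeries (CInf 𝕜 U)) :=
  Matrix.of fun i j => PowerSeries.X * secHom A (Ω.Th i j)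

/-- The mixed block `δ^i_j + t γ^i_j` of the bivector along `s_A`. -/
def blockD (A : Fin d → CInf 𝕜 U) : Matrix (Fin d) (Fin d) (PowerSeries (CInf 𝕜 U)) :=
  Matrix.of fun i j => (if i = j then 1 else 0) + PowerSeries.X * secHom A (Ω.ga i j)

/-- The `p_k`-derivative of the horizontal block. -/
def blockTp (A : Fin d → CInf 𝕜 U) (k : Fin d) :
    Matrix (Fin d) (Fin d) (PowerSeries (CInf 𝕜 U)) :=
  Matrix.of fun i j => PowerSeries.X * secHom A (dP k (Ω.Th i j))

/-- The `p_k`-derivative of the mixed block. -/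
def blockDp (A : Fin d → CInf 𝕜 U) (k : Fin d) :
    Matrix (Fin d) (Fin d) (PowerSeries (CInf 𝕜 U)) :=
  Matrix.of fun i j => PowerSeries.X * secHom A (dP k (Ω.ga i j))

theorem bform_eq_sum {R ι : Type*} [CommRing R] [Fintype ι] (T D : Matrix ι ι R)
    (u u' : (ι → R) × (ι → R)) : bform T D u u' =
      (∑ i, ∑ j, T i j * u.1 i * u'.1 j) +
        ∑ i, ∑ j, D i j * (u.1 i * u'.2 j - u.2 j * u'.1 i) := by
  simp only [bform, dotProduct, mulVec, Finset.mul_sum, mul_sub, Finset.sum_sub_distrib]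
  rw [add_sub_assoc]
  congr 1
  · exact Finset.sum_congr rfl fun i _ => Finset.sum_congr rfl fun j _ => by ring
  · congr 1
    · exact Finset.sum_congr rfl fun i _ => Finset.sum_congr rfl fun j _ => by ring
    · exact Finset.sum_congr rfl fun i _ => Finset.sum_congr rfl fun j _ => by ring

theorem pullSection_bracket (A : Fin d → CInf 𝕜 U) (F G : PowerSeries (CotPol 𝕜 U)) :
    pullSection A (Ω.bracket F G) = bform (blockT Ω A) (blockD Ω A) (grad A F) (grad A G) := by
  rw [← secHom_apply, bform_eq_sum]
  simp only [LocalSymplecticEmbedding.bracket, bracketOf, map_add, map_mul, map_sum, map_sub,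
    secHom_X, grad, blockT, blockD, Matrix.of_apply, Finset.mul_sum, mul_assoc,
    apply_ite (secHom A), map_one, map_zero]

/-- For arguments with constant momentum part and p-independent x-gradient, such as π^*h and the
constraints, ∂/∂p_k hits only the bivector. The multipliers stand outside the p-derivative in the
recursion relations, so these arguments suffice. -/
theorem pullSection_dP_bracket (A : Fin d → CInf 𝕜 U) {F G : PowerSeries (CotPol 𝕜 U)} (k : Fin d)
    (hFX : ∀ i, dP k (dX i F) = 0) (hFP : ∀ i, dP k (dP i F) = 0)
    (hGX : ∀ i, dP k (dX i G) = 0) (hGP : ∀ i, dP k (dP i G) = 0) :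
    pullSection A (dP k (Ω.bracket F G)) =
      bform (blockTp Ω A k) (blockDp Ω A k) (grad A F) (grad A G) := by
  have h0 : ∀ i j : Fin d, dP k (if i = j then 1 else 0 : PowerSeries (CotPol 𝕜 U)) = 0 := by
    intro i j
    split
    · exact dP_one k
    · exact dP_zero k
  rw [← secHom_apply, bform_eq_sum]
  simp only [LocalSymplecticEmbedding.bracket, bracketOf, dP_add, dP_mul, dP_sum, dP_sub, dP_X,
    hFX, hFP, hGX, hGP, h0, mul_zero, zero_add, add_zero, sub_zero]
  simp only [map_add, map_mul, map_sum, map_sub, secHom_X, grad, blockTp, blockDp, Matrix.of_apply,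
    Finset.mul_sum]
  refine congrArg₂ (· + ·) ?_ ?_
  · exact Finset.sum_congr rfl fun i _ => Finset.sum_congr rfl fun j _ => by ring
  · exact Finset.sum_congr rfl fun i _ => Finset.sum_congr rfl fun j _ => by ring

theorem dP_dX_pullBase (k i : Fin d) (h : PowerSeries (CInf 𝕜 U)) :
    dP k (dX i (pullBase h)) = 0 := by
  rw [dX_pullBase, dP_pullBase]

theorem dP_dP_pullBase (k i : Fin d) (h : PowerSeries (CInf 𝕜 U)) :
    dP k (dP i (pullBase h)) = 0 := by
  rw [dP_pullBase, dP_zero]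

theorem dP_dX_Phi (A : Fin d → CInf 𝕜 U) (k i l : Fin d) : dP k (dX i (Phi A l)) = 0 := by
  rw [dX_Phi, dP_neg, dP_pullBase, neg_zero]

theorem dP_dP_Phi (A : Fin d → CInf 𝕜 U) (k i l : Fin d) : dP k (dP i (Phi A l)) = 0 := by
  rw [dP_Phi]
  split
  · exact dP_one k
  · exact dP_zero k

end Gradients

/-! ### Evaluation and variation of jet functions; the two derivatives of the multipliers. -/

section Jets

open Matrix

variable {𝕜 : Type*} [RCLike 𝕜] {d : ℕ} {U : TopologicalSpace.Opens (Fin d → ℝ)}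

/-- Evaluation along the prolongation of `A` as a ring homomorphism. -/
def jetHom (A : Fin d → CInf 𝕜 U) : PowerSeries (JetPol 𝕜 U) →+* PowerSeries (CInf 𝕜 U) :=
  PowerSeries.map (MvPolynomial.eval
    (Sum.elim A fun kl : Fin d × Fin d => partialX kl.1 (A kl.2)))

theorem jetHom_X (A : Fin d → CInf 𝕜 U) : jetHom A PowerSeries.X = PowerSeries.X :=
  PowerSeries.map_X _

theorem jetHom_cotToJet (A : Fin d → CInf 𝕜 U) (F : PowerSeries (CotPol 𝕜 U)) :
    jetHom A (cotToJet F) = secHom A F := by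
  ext1 n
  simp only [jetHom, cotToJet, secHom, PowerSeries.coeff_map]
  exact (MvPolynomial.eval_rename _ _ _).trans rfl

theorem jetHom_jetJ (A : Fin d → CInf 𝕜 U) : (jetJ 𝕜 U).map (jetHom A) = jac A := by
  ext1 k m
  simp [jetJ, jac, jetHom, const]

theorem pderiv_inr_rename (kl : Fin d × Fin d) (p : CotPol 𝕜 U) :
    MvPolynomial.pderiv (Sum.inr kl) (MvPolynomial.rename Sum.inl p : JetPol 𝕜 U) = 0 := by
  induction p using MvPolynomial.induction_on with
  | C a => simp
  | add p q hp hq => simp only [map_add, hp, hq, add_zero]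
  | mul_X p i hp =>
    simp only [map_mul, MvPolynomial.rename_X, Derivation.leibniz, hp, smul_eq_mul,
      MvPolynomial.pderiv_X, Pi.single_apply, reduceCtorEq, if_false, mul_zero, add_zero]

theorem dA_cotToJet (l : Fin d) (F : PowerSeries (CotPol 𝕜 U)) :
    dA l (cotToJet F) = cotToJet (dP l F) := by
  ext1 n
  simp only [dA, cotToJet, dP, coeffwise, PowerSeries.coeff_mk, PowerSeries.coeff_map]
  exact MvPolynomial.pderiv_rename Sum.inl_injective l _

theorem dDA_cotToJet (k l : Fin d) (F : PowerSeries (CotPol 𝕜 U)) : dDA k l (cotToJet F) = 0 := by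
  ext1 n
  simp only [dDA, cotToJet, coeffwise, PowerSeries.coeff_mk, PowerSeries.coeff_map, map_zero]
  exact pderiv_inr_rename (k, l) _

/-- The derivative with respect to a fibre coordinate of the jet space, as a derivation. -/
def derJet (z : Fin d ⊕ Fin d × Fin d) :
    Derivation ℤ (PowerSeries (JetPol 𝕜 U)) (PowerSeries (JetPol 𝕜 U)) :=
  coeffDer (R := JetPol 𝕜 U)
    ((MvPolynomial.pderiv (R := CInf 𝕜 U) z : Derivation _ _ (JetPol 𝕜 U)).restrictScalars ℤ)

theorem dA_eq_derJet (l : Fin d) (F : PowerSeries (JetPol 𝕜 U)) :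
    dA l F = derJet (Sum.inl l) F := rfl

theorem dDA_eq_derJet (k l : Fin d) (F : PowerSeries (JetPol 𝕜 U)) :
    dDA k l F = derJet (Sum.inr (k, l)) F := rfl

theorem derJet_mul (z : Fin d ⊕ Fin d × Fin d) (F G : PowerSeries (JetPol 𝕜 U)) :
    derJet z (F * G) = F * derJet z G + G * derJet z F :=
  Derivation.leibniz (derJet z) F G

theorem derJet_X_pow (z : Fin d ⊕ Fin d × Fin d) (n : ℕ) :
    derJet z ((PowerSeries.X : PowerSeries (JetPol 𝕜 U)) ^ n) = 0 := by
  have h : derJet z (PowerSeries.X : PowerSeries (JetPol 𝕜 U)) = 0 := coeffDer_X (R := JetPol 𝕜 U)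
    ((MvPolynomial.pderiv (R := CInf 𝕜 U) z : Derivation _ _ (JetPol 𝕜 U)).restrictScalars ℤ)
  induction n with
  | zero => exact Derivation.map_one_eq_zero (derJet z)
  | succ n ih => rw [pow_succ, derJet_mul, ih, h, mul_zero, mul_zero, add_zero]

theorem derJet_C_X (z y : Fin d ⊕ Fin d × Fin d) :
    derJet z (PowerSeries.C (MvPolynomial.X y) : PowerSeries (JetPol 𝕜 U)) =
      if z = y then 1 else 0 := by
  have := coeffDer_C (R := JetPol 𝕜 U)
    ((MvPolynomial.pderiv (R := CInf 𝕜 U) z : Derivation _ _ (JetPol 𝕜 U)).restrictScalars ℤ)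
    (MvPolynomial.X y)
  refine this.trans ?_
  change PowerSeries.C (MvPolynomial.pderiv z (MvPolynomial.X y : JetPol 𝕜 U)) = _
  rw [MvPolynomial.pderiv_X, Pi.single_apply]
  by_cases h : z = y
  · simp [h]
  · simp [h, Ne.symm h]

/-- The first order variation at `A` of a function on the jet space, in the direction `a`. -/
def jetVar (A : Fin d → CInf 𝕜 U) (a : Fin d → PowerSeries (CInf 𝕜 U)) :
    PowerSeries (JetPol 𝕜 U) →+ PowerSeries (CInf 𝕜 U) :=
  AddMonoidHom.mk' (fun F => (∑ l, jetHom A (dA l F) * a l) +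
    ∑ k, ∑ l, jetHom A (dDA k l F) * dBaseHom k (a l)) (fun F G => by
      simp only [dA_eq_derJet, dDA_eq_derJet, map_add, add_mul, Finset.sum_add_distrib]
      exact add_add_add_comm _ _ _ _)

theorem jetVar_apply (A : Fin d → CInf 𝕜 U) (a : Fin d → PowerSeries (CInf 𝕜 U))
    (F : PowerSeries (JetPol 𝕜 U)) :
    jetVar A a F = (∑ l, jetHom A (dA l F) * a l) +
      ∑ k, ∑ l, jetHom A (dDA k l F) * dBaseHom k (a l) := rfl

theorem jetVar_mul (A : Fin d → CInf 𝕜 U) (a : Fin d → PowerSeries (CInf 𝕜 U))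
    (F G : PowerSeries (JetPol 𝕜 U)) :
    jetVar A a (F * G) = jetVar A a F * jetHom A G + jetHom A F * jetVar A a G := by
  simp only [jetVar_apply, dA_eq_derJet, dDA_eq_derJet, derJet_mul, map_add, map_mul, add_mul,
    Finset.sum_add_distrib, mul_assoc, ← Finset.mul_sum]
  ring

theorem jetVar_X_pow_mul (A : Fin d → CInf 𝕜 U) (a : Fin d → PowerSeries (CInf 𝕜 U)) (n : ℕ)
    (F : PowerSeries (JetPol 𝕜 U)) :
    jetVar A a (PowerSeries.X ^ n * F) = PowerSeries.X ^ n * jetVar A a F := by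
  have h : jetVar A a (PowerSeries.X ^ n) = 0 := by
    simp only [jetVar_apply, dA_eq_derJet, dDA_eq_derJet, derJet_X_pow, map_zero, zero_mul,
      Finset.sum_const_zero, add_zero]
  rw [jetVar_mul, h, zero_mul, zero_add, map_pow, jetHom_X]

theorem jetVar_cotToJet (A : Fin d → CInf 𝕜 U) (a : Fin d → PowerSeries (CInf 𝕜 U))
    (F : PowerSeries (CotPol 𝕜 U)) :
    jetVar A a (cotToJet F) = ∑ l, a l * secHom A (dP l F) := by
  simp [jetVar_apply, dA_cotToJet, dDA_cotToJet, jetHom_cotToJet, mul_comm]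

theorem jetVar_jetJ (A : Fin d → CInf 𝕜 U) (a : Fin d → PowerSeries (CInf 𝕜 U)) :
    (jetJ 𝕜 U).map (jetVar A a) = Matrix.of fun k l => dBaseHom k (a l) := by
  ext1 k m
  simp only [Matrix.map_apply, jetJ, Matrix.of_apply, jetVar_apply, dA_eq_derJet, dDA_eq_derJet, derJet_C_X,
    reduceCtorEq, if_false, map_zero, zero_mul, Finset.sum_const_zero, zero_add, Sum.inr.injEq,
    Prod.mk.injEq]
  rw [Finset.sum_eq_single k, Finset.sum_eq_single m]
  · simp
  · intro b _ hb
    simp [hb]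
  · simp
  · intro b _ hb
    simp [hb]
  · simp

variable (Λ : Fin d → Fin d → PowerSeries (CotPol 𝕜 U)) (A : Fin d → CInf 𝕜 U)

/-- The matrix `t² Λ^{ij}` along `A`. -/
def lamMat : Matrix (Fin d) (Fin d) (PowerSeries (CInf 𝕜 U)) :=
  Matrix.of fun a b => PowerSeries.X ^ 2 * secHom A (Λ a b)

/-- The matrix `t² L^{ij}` along `A`. -/
def mulMat : Matrix (Fin d) (Fin d) (PowerSeries (CInf 𝕜 U)) :=
  Matrix.of fun a b => PowerSeries.X ^ 2 * jetHom A (seriesL Λ a b)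

/-- The first order variation of `t² L^{ij}` in the direction `a`. -/
def mulVar (a : Fin d → PowerSeries (CInf 𝕜 U)) :
    Matrix (Fin d) (Fin d) (PowerSeries (CInf 𝕜 U)) :=
  Matrix.of fun i j => PowerSeries.X ^ 2 * jetVar A a (seriesL Λ i j)

theorem jet_resolvent :
    (PowerSeries.X : PowerSeries (JetPol 𝕜 U)) ^ 2 • Matrix.of (seriesL Λ) +
      ((PowerSeries.X : PowerSeries (JetPol 𝕜 U)) ^ 2 • Matrix.of (seriesL Λ)) * jetJ 𝕜 U *
        ((PowerSeries.X : PowerSeries (JetPol 𝕜 U)) ^ 2 • jetMat Λ) =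
      (PowerSeries.X : PowerSeries (JetPol 𝕜 U)) ^ 2 • jetMat Λ := by
  conv_rhs => rw [← seriesL_add_mul Λ]
  rw [Matrix.smul_mul, Matrix.smul_mul, Matrix.mul_smul, smul_add]

theorem jetHom_mulMat :
    ((PowerSeries.X : PowerSeries (JetPol 𝕜 U)) ^ 2 • Matrix.of (seriesL Λ)).map (jetHom A) =
      mulMat Λ A := by
  ext1 i j
  simp [mulMat, jetHom_X]

theorem jetHom_lamMat :
    ((PowerSeries.X : PowerSeries (JetPol 𝕜 U)) ^ 2 • jetMat Λ).map (jetHom A) = lamMat Λ A := by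
  ext1 i j
  simp [lamMat, jetMat, jetHom_X, jetHom_cotToJet]

/-- The factors t² are absorbed into K and l, so the identity along A carries no power of t. -/
theorem mulMat_resolvent :
    mulMat Λ A + mulMat Λ A * jac A * lamMat Λ A = lamMat Λ A := by
  have := congrArg (fun M => M.map (jetHom A)) (jet_resolvent Λ)
  simpa only [Matrix.map_add _ (map_add (jetHom A)), Matrix.map_mul, jetHom_mulMat, jetHom_lamMat,
    jetHom_jetJ] using this

theorem mulMat_derivative (k : Fin d) : (mulMat Λ A).map (dBaseHom k) =
    (1 - mulMat Λ A * jac A) * (lamMat Λ A).map (dBaseHom k) * (1 - jac A * mulMat Λ A) -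
      mulMat Λ A * (jac A).map (dBaseHom k) * mulMat Λ A := by
  refine resolvent_derivative (mulMat_resolvent Λ A) ?_
  have h := congrArg (fun M => M.map (dBaseHom k)) (mulMat_resolvent Λ A)
  have hm := map_mul_of_leibniz (ι := Fin d) (RingHom.id (PowerSeries (CInf 𝕜 U))) (dBaseHom k)
    (dBaseHom_mul k)
  have hid : ∀ M : Matrix (Fin d) (Fin d) (PowerSeries (CInf 𝕜 U)),
      M.map (RingHom.id (PowerSeries (CInf 𝕜 U))) = M := fun M => rfl
  simp only [Matrix.map_add _ (map_add (dBaseHom k)), hm, hid] at h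
  rw [add_assoc]
  exact h

/-- The variation needs the dependence on A and ∂A separately, so the identity is varied on the jet
space and evaluated in the same step. The series is never varied term by term. -/
theorem mulVar_eq (a : Fin d → PowerSeries (CInf 𝕜 U)) : mulVar Λ A a =
    (1 - mulMat Λ A * jac A) *
        (∑ n, a n • (Matrix.of fun i j => PowerSeries.X ^ 2 * secHom A (dP n (Λ i j)))) *
        (1 - jac A * mulMat Λ A) -
      mulMat Λ A * (Matrix.of fun k l => dBaseHom k (a l)) * mulMat Λ A := by
  refine resolvent_derivative (mulMat_resolvent Λ A) ?_
  have h := congrArg (fun M => M.map (jetVar A a)) (jet_resolvent Λ)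
  have hm := map_mul_of_leibniz (ι := Fin d) (jetHom A) (jetVar A a) (jetVar_mul A a)
  have h1 : ((PowerSeries.X : PowerSeries (JetPol 𝕜 U)) ^ 2 • Matrix.of (seriesL Λ)).map
      (jetVar A a) = mulVar Λ A a := by
    ext1 i j
    simp [mulVar, jetVar_X_pow_mul]
  have h2 : ((PowerSeries.X : PowerSeries (JetPol 𝕜 U)) ^ 2 • jetMat Λ).map (jetVar A a) =
      ∑ n, a n • (Matrix.of fun i j => PowerSeries.X ^ 2 * secHom A (dP n (Λ i j))) := by
    ext1 i j
    simp only [Matrix.map_apply, Matrix.smul_apply, smul_eq_mul, jetVar_X_pow_mul, jetMat,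
      Matrix.of_apply, jetVar_cotToJet, Matrix.sum_apply, Finset.mul_sum, mul_left_comm]
  simp only [Matrix.map_add _ (map_add (jetVar A a)), hm, h1, h2, jetVar_jetJ, jetHom_mulMat,
    jetHom_lamMat, jetHom_jetJ, Matrix.map_mul] at h
  rw [add_assoc]
  exact h

end Jets

/-! ### Identification of the recursion relations with the defect, and the equivalence. -/

section Main

open Matrix

variable {𝕜 : Type*} [RCLike 𝕜] {d : ℕ} {U : TopologicalSpace.Opens (Fin d → ℝ)}
variable {θ : AlmostPoissonStructure 𝕜 U} (Ω : LocalSymplecticEmbedding θ)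
variable (Λ : Fin d → Fin d → PowerSeries (CotPol 𝕜 U)) (A : Fin d → CInf 𝕜 U)

/-- The differential of a function on `U`. -/
def diffVec (f : CInf 𝕜 U) : Fin d → PowerSeries (CInf 𝕜 U) := fun k => dBaseHom k (const f)

/-- The gradient along `s_A` of `π^*f + Φ_A(L_f)`. -/
def dressed (f : CInf 𝕜 U) :
    (Fin d → PowerSeries (CInf 𝕜 U)) × (Fin d → PowerSeries (CInf 𝕜 U)) :=
  ((1 - jac A * mulMat Λ A) *ᵥ diffVec f, mulMat Λ A *ᵥ diffVec f)

/-- The `x^k`-derivative of `t² Λ` along `s_A`. -/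
def lamX (k : Fin d) : Matrix (Fin d) (Fin d) (PowerSeries (CInf 𝕜 U)) :=
  Matrix.of fun a b => PowerSeries.X ^ 2 * secHom A (dX k (Λ a b))

/-- The `p_k`-derivative of `t² Λ` along `s_A`. -/
def lamP (k : Fin d) : Matrix (Fin d) (Fin d) (PowerSeries (CInf 𝕜 U)) :=
  Matrix.of fun a b => PowerSeries.X ^ 2 * secHom A (dP k (Λ a b))

/-- The `x^k`-derivative of the horizontal block. -/
def blockTx (k : Fin d) : Matrix (Fin d) (Fin d) (PowerSeries (CInf 𝕜 U)) :=
  Matrix.of fun i j => PowerSeries.X * secHom A (dX k (Ω.Th i j))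

/-- The `x^k`-derivative of the mixed block. -/
def blockDx (k : Fin d) : Matrix (Fin d) (Fin d) (PowerSeries (CInf 𝕜 U)) :=
  Matrix.of fun i j => PowerSeries.X * secHom A (dX k (Ω.ga i j))

theorem jac_closed (k m n : Fin d) :
    dBaseHom k (jac A m n) = dBaseHom m (jac A k n) := by
  simp only [jac, Matrix.of_apply, dBaseHom_const, partialX_comm k m]

theorem lamMat_chain (k : Fin d) :
    (lamMat Λ A).map (dBaseHom k) = lamX Λ A k + ∑ m, jac A k m • lamP Λ A m := by
  ext1 a b
  simp only [lamMat, lamX, lamP, jac, Matrix.map_apply, Matrix.of_apply, dBaseHom_X_pow_mul,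
    dBase_pullSection, Matrix.add_apply, Matrix.sum_apply, Matrix.smul_apply, smul_eq_mul, mul_add,
    Finset.mul_sum, mul_left_comm]

theorem blockT_chain (k : Fin d) :
    (blockT Ω A).map (dBaseHom k) = blockTx Ω A k + ∑ m, jac A k m • blockTp Ω A m := by
  ext1 a b
  simp only [blockT, blockTx, blockTp, jac, Matrix.map_apply, Matrix.of_apply, dBaseHom_X_mul,
    dBase_pullSection, Matrix.add_apply, Matrix.sum_apply, Matrix.smul_apply, smul_eq_mul, mul_add,
    Finset.mul_sum, mul_left_comm]

theorem blockD_chain (k : Fin d) :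
    (blockD Ω A).map (dBaseHom k) = blockDx Ω A k + ∑ m, jac A k m • blockDp Ω A m := by
  have h1 : dBaseHom k (1 : PowerSeries (CInf 𝕜 U)) = 0 :=
    Derivation.map_one_eq_zero (coeffDer (derX k))
  have h0 : ∀ a b : Fin d, dBaseHom k (if a = b then 1 else 0 : PowerSeries (CInf 𝕜 U)) = 0 := by
    intro a b
    split
    · exact h1
    · exact map_zero _
  ext1 a b
  simp only [blockD, blockDx, blockDp, jac, Matrix.map_apply, Matrix.of_apply, map_add, h0,
    zero_add, dBaseHom_X_mul,
    dBase_pullSection, Matrix.add_apply, Matrix.sum_apply, Matrix.smul_apply, smul_eq_mul, mul_add,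
    Finset.mul_sum, mul_left_comm]

theorem blockT_skew : (blockT Ω A)ᵀ = -blockT Ω A := by
  ext1 i j
  simp only [blockT, Matrix.transpose_apply, Matrix.of_apply, Matrix.neg_apply, Ω.skew j i, map_neg,
    mul_neg]

theorem blockTp_skew (k : Fin d) : (blockTp Ω A k)ᵀ = -blockTp Ω A k := by
  ext1 i j
  simp only [blockTp, Matrix.transpose_apply, Matrix.of_apply, Matrix.neg_apply, Ω.skew j i, dP_neg,
    map_neg, mul_neg]

theorem mult_seriesL (h : PowerSeries (CInf 𝕜 U)) :
    mult (seriesL Λ) A h = mulMat Λ A *ᵥ fun k => dBaseHom k h := by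
  ext1 i
  simp only [mult, mulMat, mulVec, dotProduct, Matrix.of_apply, Finset.mul_sum, mul_assoc]
  rfl

theorem varMult_seriesL (f g : CInf 𝕜 U) (i : Fin d) :
    varMult Ω (seriesL Λ) A f g i =
      (mulVar Λ A (gaugeVar Ω (seriesL Λ) A f) *ᵥ diffVec g) i := by
  simp only [varMult, mulVar, mulVec, dotProduct, Matrix.of_apply, Finset.mul_sum, mul_assoc]
  rfl

theorem grad_dressed (f : CInf 𝕜 U) :
    grad A (pullBase (const f) + PhiV A (mult (seriesL Λ) A (const f))) = dressed Λ A f := by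
  rw [grad_add, grad_pullBase, grad_PhiV, mult_seriesL, dressed, sub_mulVec, one_mulVec,
    ← mulVec_mulVec, Prod.mk_add_mk, zero_add, sub_eq_add_neg]
  rfl

theorem dressed_eq_add (f : CInf 𝕜 U) : dressed Λ A f = (diffVec f, 0) +
    (-(jac A *ᵥ (mulMat Λ A *ᵥ diffVec f)), mulMat Λ A *ᵥ diffVec f) := by
  rw [dressed, sub_mulVec, one_mulVec, ← mulVec_mulVec, Prod.mk_add_mk, zero_add, sub_eq_add_neg]

/-- The gradient of the n-th constraint is (-J e_n, e_n), which gives the form of `a` required by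
`variation_add_transport`. -/
theorem gaugeVar_eq_sharp (f : CInf 𝕜 U) (n : Fin d) :
    gaugeVar Ω (seriesL Λ) A f n = sharpV (blockD Ω A) (dressed Λ A f) n -
      ∑ m, sharpH (blockT Ω A) (blockD Ω A) (dressed Λ A f) m * jac A m n := by
  rw [gaugeVar, pullSection_bracket, grad_dressed, grad_Phi, bform_eq_sharp, dotProduct_neg,
    dotProduct_single, mul_one, mulVec_single_one]
  simp only [dotProduct, Matrix.col_apply]
  ring

theorem tFieldBracket_eq (f g : CInf 𝕜 U) : tFieldBracket Ω (seriesL Λ) A f g =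
    bform (blockT Ω A) (blockD Ω A) (diffVec f, 0) (diffVec g, 0) -
      bform (blockT Ω A) (blockD Ω A)
        (-(jac A *ᵥ (mulMat Λ A *ᵥ diffVec f)), mulMat Λ A *ᵥ diffVec f)
        (-(jac A *ᵥ (mulMat Λ A *ᵥ diffVec g)), mulMat Λ A *ᵥ diffVec g) := by
  rw [tFieldBracket, pullSection_bracket, pullSection_bracket, grad_pullBase, grad_pullBase,
    grad_PhiV, grad_PhiV, mult_seriesL, mult_seriesL]
  rfl

/-- The vector whose vanishing for all `f`, `g`, `A` expresses the recursion relations. -/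
def recursionDefect (f g : CInf 𝕜 U) : Fin d → PowerSeries (CInf 𝕜 U) :=
  defect (lamX Λ A) (lamP Λ A) (blockTx Ω A) (blockTp Ω A) (blockDx Ω A) (blockDp Ω A)
    (lamMat Λ A) (blockT Ω A) (blockD Ω A) (dressed Λ A f) (dressed Λ A g)

theorem recursion_rhs_sub_lhs (f g : CInf 𝕜 U) (i : Fin d) :
    let f' := pullBase (const f)
    let g' := pullBase (const g)
    let Lf := mult (seriesL Λ) A (const f)
    let Lg := mult (seriesL Λ) A (const g)
    (varMult Ω (seriesL Λ) A f g i - varMult Ω (seriesL Λ) A g f i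
      + pullSection A (dP i (Ω.bracket f' g'))
      + (∑ j, ∑ k, Lf j * Lg k * pullSection A (dP i (Ω.bracket (Phi A j) (Phi A k))))
      + pullSection A (Ω.bracket f' (pullBase (Lg i)))
      - pullSection A (Ω.bracket g' (pullBase (Lf i)))
      + pullSection A (Ω.bracket (pullBase (Lf i)) (PhiV A Lg))
      - pullSection A (Ω.bracket (pullBase (Lg i)) (PhiV A Lf))
      + (∑ j, Lg j * pullSection A (dP i (Ω.bracket f' (Phi A j))))
      - (∑ j, Lf j * pullSection A (dP i (Ω.bracket g' (Phi A j))))) -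
      mult (seriesL Λ) A (tFieldBracket Ω (seriesL Λ) A f g) i =
    ((1 - mulMat Λ A * jac A) *ᵥ recursionDefect Ω Λ A f g) i := by
  intro f' g' Lf Lg
  have hcore := recursion_sub_eq_defect dBaseHom dBaseHom_mul (lamX Λ A) (lamP Λ A)
    (blockTx Ω A) (blockTp Ω A) (blockDx Ω A) (blockDp Ω A) (jac_closed A) (blockT_skew Ω A)
    (mulMat_resolvent Λ A) (mulMat_derivative Λ A) (lamMat_chain Λ A) (blockT_chain Ω A)
    (blockD_chain Ω A) (diffVec f) (diffVec g) (fun k m => dBaseHom_comm k m f)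
    (fun k m => dBaseHom_comm k m g) (rfl : dressed Λ A f = _) (rfl : dressed Λ A g = _)
    _ _ (gaugeVar_eq_sharp Ω Λ A f) (gaugeVar_eq_sharp Ω Λ A g) (mulVar_eq Λ A _)
    (mulVar_eq Λ A _) (tFieldBracket_eq Ω Λ A f g)
  have hcore_i := congrFun hcore i
  rw [recursionDefect, ← hcore_i]
  have hLf : Lf = mulMat Λ A *ᵥ diffVec f := mult_seriesL Λ A (const f)
  have hLg : Lg = mulMat Λ A *ᵥ diffVec g := mult_seriesL Λ A (const g)
  have hgf : grad A f' = (diffVec f, 0) := grad_pullBase A (const f)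
  have hgg : grad A g' = (diffVec g, 0) := grad_pullBase A (const g)
  have hPP : ∑ j, ∑ k, Lf j * Lg k * pullSection A (dP i (Ω.bracket (Phi A j) (Phi A k))) =
      bform (blockTp Ω A i) (blockDp Ω A i) (-(jac A *ᵥ Lf), Lf) (-(jac A *ᵥ Lg), Lg) := by
    rw [← sum_smul_grad_Phi, ← sum_smul_grad_Phi, bform_sum_left]
    refine Finset.sum_congr rfl fun j _ => ?_
    rw [bform_sum_right, Finset.mul_sum]
    refine Finset.sum_congr rfl fun k _ => ?_
    rw [pullSection_dP_bracket Ω A i (fun _ => dP_dX_Phi A _ _ _) (fun _ => dP_dP_Phi A _ _ _)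
      (fun _ => dP_dX_Phi A _ _ _) (fun _ => dP_dP_Phi A _ _ _), mul_assoc]
  have hfP : ∀ (h : PowerSeries (CInf 𝕜 U)) (V : Fin d → PowerSeries (CInf 𝕜 U)),
      ∑ j, V j * pullSection A (dP i (Ω.bracket (pullBase h) (Phi A j))) =
      bform (blockTp Ω A i) (blockDp Ω A i) (grad A (pullBase h)) (-(jac A *ᵥ V), V) := by
    intro h V
    rw [← sum_smul_grad_Phi, bform_sum_right]
    refine Finset.sum_congr rfl fun j _ => ?_
    rw [pullSection_dP_bracket Ω A i (fun _ => dP_dX_pullBase _ _ _)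
      (fun _ => dP_dP_pullBase _ _ _) (fun _ => dP_dX_Phi A _ _ _) (fun _ => dP_dP_Phi A _ _ _)]
  have hfg : pullSection A (dP i (Ω.bracket f' g')) =
      bform (blockTp Ω A i) (blockDp Ω A i) (diffVec f, 0) (diffVec g, 0) := by
    rw [pullSection_dP_bracket Ω A i (fun _ => dP_dX_pullBase _ _ _)
      (fun _ => dP_dP_pullBase _ _ _) (fun _ => dP_dX_pullBase _ _ _)
      (fun _ => dP_dP_pullBase _ _ _), hgf, hgg]
  -- The two brackets of L_g^i, with π^*f and with Φ_A(L_f), together are the derivative of L_g^i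
  -- along the vector of the dressed covector of f.
  have hT : ∀ (f : CInf 𝕜 U) (h : PowerSeries (CInf 𝕜 U)),
      (∑ m, sharpH (blockT Ω A) (blockD Ω A) (dressed Λ A f) m • dBaseHom m h) =
      pullSection A (Ω.bracket (pullBase (const f)) (pullBase h)) -
      pullSection A (Ω.bracket (pullBase h) (PhiV A (mulMat Λ A *ᵥ diffVec f))) := by
    intro f h
    have h1 : (∑ m, sharpH (blockT Ω A) (blockD Ω A) (dressed Λ A f) m • dBaseHom m h) =
        bform (blockT Ω A) (blockD Ω A) (dressed Λ A f) (grad A (pullBase h)) := by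
      rw [grad_pullBase, bform_eq_sharp]
      simp [dotProduct]
    rw [h1, pullSection_bracket, pullSection_bracket, dressed_eq_add, bform_add_left, grad_PhiV,
      bform_swap (blockD Ω A) (grad A (pullBase h)) _ (blockT_skew Ω A), grad_pullBase A (const f)]
    simp only [sub_neg_eq_add]
    rfl
  have hTf := hT f (Lg i)
  have hTg := hT g (Lf i)
  -- Likewise the four terms with ∂/∂p_i assemble into a single value of the p-derivative of the
  -- bivector on the two dressed covectors.
  have hsw : bform (blockTp Ω A i) (blockDp Ω A i) (dressed Λ A f) (dressed Λ A g) =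
      bform (blockTp Ω A i) (blockDp Ω A i) (diffVec f, 0) (diffVec g, 0)
      + bform (blockTp Ω A i) (blockDp Ω A i) (diffVec f, 0) (-(jac A *ᵥ Lg), Lg)
      - bform (blockTp Ω A i) (blockDp Ω A i) (diffVec g, 0) (-(jac A *ᵥ Lf), Lf)
      + bform (blockTp Ω A i) (blockDp Ω A i) (-(jac A *ᵥ Lf), Lf) (-(jac A *ᵥ Lg), Lg) := by
    rw [bform_swap (blockDp Ω A i) (diffVec g, 0) _ (blockTp_skew Ω A i), dressed_eq_add,
      dressed_eq_add, hLf, hLg]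
    simp only [bform_add_left, bform_add_right]
    ring
  rw [hfg, hPP, hfP, hfP, hgf, hgg, varMult_seriesL, varMult_seriesL, mult_seriesL]
  simp only [Pi.sub_apply, Pi.add_apply, Finset.sum_apply, Pi.smul_apply, Function.comp_apply]
  rw [← hLf, ← hLg, hTf, hTg, hsw, hLf, hLg]
  ring

/-- The difference of the two sides of the differential system. -/
def systemDefect (i j k : Fin d) : PowerSeries (CotPol 𝕜 U) :=
  (PowerSeries.X * (dP i (Λ k j) - dP j (Λ k i))
      + PowerSeries.X ^ 3 * (∑ l, (Λ l j * dX l (Λ k i) - Λ l i * dX l (Λ k j)))) -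
    (-dP k (Ω.Th i j)
      + PowerSeries.X ^ 2 * (∑ l,
          (Λ k l * dX l (Ω.Th i j)
            + Λ l i * dP k (Ω.ga j l) - Λ l j * dP k (Ω.ga i l)
            + Ω.Th j l * dX l (Λ k i) - Ω.Th i l * dX l (Λ k j)
            + Ω.ga j l * dP l (Λ k i) - Ω.ga i l * dP l (Λ k j)))
      + PowerSeries.X ^ 4 * (∑ l, ∑ m,
          (Ω.ga l m * Λ m i * dX l (Λ k j) - Ω.ga l m * Λ m j * dX l (Λ k i)
            + Λ k l * Λ m j * dX l (Ω.ga i m) - Λ k l * Λ m i * dX l (Ω.ga j m))))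

theorem diffSystem_iff : DiffSystem Ω Λ ↔ ∀ i j k, systemDefect Ω Λ i j k = 0 := by
  simp only [DiffSystem, systemDefect, sub_eq_zero]

theorem defectMatrix_eq_systemDefect (i j k : Fin d) :
    defectMatrix (lamX Λ A) (lamP Λ A) (blockTx Ω A) (blockTp Ω A) (blockDx Ω A) (blockDp Ω A)
      (lamMat Λ A) (blockT Ω A) (blockD Ω A) k i j =
    PowerSeries.X * secHom A (systemDefect Ω Λ i j k) := by
  refine (defectMatrix_apply PowerSeries.X (fun a b => secHom A (Λ a b))
    (fun a b => secHom A (Ω.Th a b)) (fun a b => secHom A (Ω.ga a b))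
    (fun m a b => secHom A (dX m (Λ a b))) (fun m a b => secHom A (dP m (Λ a b)))
    (fun m a b => secHom A (dX m (Ω.Th a b))) (fun m a b => secHom A (dP m (Ω.Th a b)))
    (fun m a b => secHom A (dX m (Ω.ga a b))) (fun m a b => secHom A (dP m (Ω.ga a b)))
    i j k).trans ?_
  simp only [systemDefect, map_add, map_sub, map_mul, map_neg, map_sum, map_pow, secHom_X]

/-- Supplies the test functions for the converse: coordinate functions have the standard basis as
differentials. -/
theorem diffVec_coordFun (c : Fin d) :
    diffVec (coordFun c : CInf 𝕜 U) = Pi.single c 1 := by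
  ext1 k
  rw [diffVec, dBaseHom_const, partialX_coordFun, Pi.single_apply, const]
  split <;> simp

theorem solvesRecursion_iff : SolvesRecursion Ω (seriesL Λ) ↔
    ∀ (f g : CInf 𝕜 U) (A : Fin d → CInf 𝕜 U),
      (1 - mulMat Λ A * jac A) *ᵥ recursionDefect Ω Λ A f g = 0 := by
  constructor
  · intro h f g A
    ext1 i
    rw [← recursion_rhs_sub_lhs]
    exact sub_eq_zero.mpr (h f g A i).symm
  · intro h f g A i
    have := recursion_rhs_sub_lhs Ω Λ A f g i
    rw [h f g A] at this
    exact (sub_eq_zero.mp this).symm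

theorem solvesRecursion_iff_diffSystem :
    SolvesRecursion Ω (seriesL Λ) ↔ DiffSystem Ω Λ := by
  rw [solvesRecursion_iff, diffSystem_iff]
  constructor
  · intro h i j k
    refine eq_zero_of_pullSection _ fun A => ?_
    have hZ := defectMatrix_eq_zero (lamX Λ A) (lamP Λ A) (blockTx Ω A) (blockTp Ω A)
      (blockDx Ω A) (blockDp Ω A) (T := blockT Ω A) (D := blockD Ω A) (mulMat_resolvent Λ A)
      (fun c e => by
        simpa only [recursionDefect, dressed, diffVec_coordFun] using
          h (coordFun c) (coordFun e) A) k
    have hij := defectMatrix_eq_systemDefect Ω Λ A i j k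
    rw [hZ, Matrix.zero_apply] at hij
    rw [← secHom_apply]
    ext1 n
    -- The overall factor t is cancelled by reading the coefficient of t^(n+1).
    simpa [PowerSeries.coeff_succ_X_mul] using congrArg (PowerSeries.coeff (n + 1)) hij.symm
  · intro h f g A
    have : recursionDefect Ω Λ A f g = 0 :=
      defect_eq_zero _ _ _ _ _ _ (mulMat_resolvent Λ A) (fun k => by
        ext1 i j
        rw [defectMatrix_eq_systemDefect, h, map_zero, mul_zero, Matrix.zero_apply]) _ _
    rw [this, mulVec_zero]

end Main

end AlmostPoisson

end

theorem proposition4p5 {𝕜 : Type*} [RCLike 𝕜] {d : ℕ} (U : TopologicalSpace.Opens (Fin d → ℝ))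
    (θ : AlmostPoisson.AlmostPoissonStructure 𝕜 U)
    (Ω : AlmostPoisson.LocalSymplecticEmbedding θ)
    (Λ : Fin d → Fin d → PowerSeries (AlmostPoisson.CotPol 𝕜 U)) :
    AlmostPoisson.SolvesRecursion Ω (AlmostPoisson.seriesL Λ) ↔
      AlmostPoisson.DiffSystem Ω Λ :=
  AlmostPoisson.solvesRecursion_iff_diffSystem Ω Λ
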